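/- Order $\mathbb R^n$ componentwise: $x\preceq y$ iff $x_i\le y_i$ for all $i$; $x\prec y$ iff $x\preceq y$ and $x\ne y$; $x\ll y$ iff $x_i<y_i$ for all $i$. A set $A$ is order-convex if $x\preceq z\preceq y$ and $x,y\in A$ imply $z\in A$. Write $\partial A$ for the topological boundary of $A$ in $\mathbb R^n$, and put $$\max A=\{y\in\partial A : z\gg y \Rightarrow z\notin A\},\qquad \min A=\{y\in\partial A : z\ll y\Rightarrow z\notin A\}$$ (the sets of maximal and of minimal elements of $A$). Let $D\subseteq\mathbb R^n$ be open and order-convex (for instance $D=\mathbb R^n$), and let $f:D\to\mathbb R^n$ be of class $C^2$. Let $\phi(t,x)$ denote the solution of $\dot x=f(x)$ with $\phi(0,x)=x$. Let $x^*\in D$ be a stable hyperbolic fixed point, that is, $f(x^*)=0$ and all eigenvalues of the Jacobian matrix $J(x^*)$ have negative real part. Let $\mathcal B$ be its basin of attraction, the set of all $x\in D$ for which $\phi(t,x)$ exists in $D$ for all $t\ge0$ and converges to $x^*$ as $t\to\infty$. Assume that the system is monotone on $\mathcal B$: $x\preceq y$ implies $\phi(t,x)\preceq\phi(t,y)$ for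 all $x,y\in\mathcal B$ and $t\ge0$. Let $\lambda_1$ be a real eigenvalue of $J(x^*)$ such that all other complex eigenvalues have real part less than $\lambda_1$, and let $v_1\in\mathbb R^n$ satisfy $J(x^*)v_1=\lambda_1v_1$, with the sign chosen so that $v_1$ has at least one positive component. Let $s_1\in C^1(\mathcal B)$ be a real eigenfunction of the Koopman semigroup for $\lambda_1$, that is, $s_1(\phi(t,x))=e^{\lambda_1t}s_1(x)$ for $x\in\mathcal B$, $t\ge0$, normalized by $v_1^T\nabla s_1(x^*)=1$. If $\lambda_1$ is not a simple eigenvalue, so that $s_1$ is not unique, let $s_1$ be chosen increasing, i.e. $s_1(x)\le s_1(y)$ for all $x\preceq y$ in $\mathcal B$. For $0\le\alpha<\infty$ put $\mathcal B_\alpha=\{x\in\mathcal B:|s_1(x)|\le\alpha\}$, and put $\mathcal B_\infty=\mathcal B$. Then the following hold. (i) For every $\alpha\in[0,\infty]$, $\mathcal B_\alpha$ is order-convex and path-connected. (ii) For every $\alpha\in[0,\infty]$, $\partial\mathcal B_\alpha=\min\mathcal B_\alpha\cup\max\mathcal B_\alpha$, and neither $\min\mathcal B_\alpha$ nor $\max\mathcal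 B_\alpha$ contains two points $x,y$ with $x\gg y$. The sets $\min\mathcal B_\alpha\setminus\max\mathcal B_\alpha$ and $\max\mathcal B_\alpha\setminus\min\mathcal B_\alpha$ are (possibly empty) embedded topological hypersurfaces of $\mathbb R^n$. Moreover, for $0\le\alpha<\infty$ the boundary of $\mathcal B_\alpha$ relative to $\mathcal B$ is the isostable $$\partial\mathcal B_\alpha\cap\mathcal B=\{x\in\mathcal B:|s_1(x)|=\alpha\}=\{x\in\mathcal B:s_1(x)=-\alpha\}\cup\{x\in\mathcal B:s_1(x)=\alpha\},$$ and $$\mathcal B\cap\min\mathcal B_\alpha=\{x\in\mathcal B:s_1(x)=-\alpha\},\qquad \mathcal B\cap\max\mathcal B_\alpha=\{x\in\mathcal B:s_1(x)=\alpha\};$$ these two sets are (possibly empty) embedded $C^1$ hypersurfaces. (iii) If the system is strongly monotone on $\mathcal B$ (monotone on $\mathcal B$, and $x\prec y$ implies $\phi(t,x)\ll\phi(t,y)$ for all $x,y\in\mathcal B$ and $t>0$), then for every finite $\alpha\ge0$ neither $\{x\in\mathcal B:s_1(x)=-\alpha\}$ nor $\{x\in\mathcal B:s_1(x)=\alpha\}$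 contains two points $x,y$ with $x\succ y$. -/

import Mathlib

open Set Filter Topology
open scoped ENNReal

namespace MonotoneSystems

/-- `γ` is a solution of `ẋ = f(x)` on `[0, ∞)` which stays in the domain `D` of `f`. -/
def IsForwardSolution {n : ℕ} (f : (Fin n → ℝ) → (Fin n → ℝ)) (D : Set (Fin n → ℝ))
    (γ : ℝ → (Fin n → ℝ)) : Prop :=
  (∀ t, 0 ≤ t → γ t ∈ D) ∧ IsIntegralCurveOn γ (fun _ => f) (Ici 0)

/-- The basin of attraction of `p`: the initial states whose solution converges to `p`. -/
def basin {n : ℕ} (f : (Fin n → ℝ) → (Fin n → ℝ)) (D : Set (Fin n → ℝ)) (p : Fin n → ℝ) :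
    Set (Fin n → ℝ) :=
  {x | ∃ γ : ℝ → (Fin n → ℝ), IsForwardSolution f D γ ∧ γ 0 = x ∧ Tendsto γ atTop (𝓝 p)}

/-- The Jacobian matrix of `f` at `p`. -/
noncomputable def jacobian {n : ℕ} (f : (Fin n → ℝ) → (Fin n → ℝ)) (p : Fin n → ℝ) :
    Matrix (Fin n) (Fin n) ℝ :=
  LinearMap.toMatrix' (fderiv ℝ f p : (Fin n → ℝ) →ₗ[ℝ] (Fin n → ℝ))

/-- `μ` is a (complex) eigenvalue of the real matrix `A`. -/
def IsEigenvalue {n : ℕ} (A : Matrix (Fin n) (Fin n) ℝ) (μ : ℂ) : Prop :=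
  ∃ v : Fin n → ℂ, v ≠ 0 ∧ (A.map Complex.ofReal).mulVec v = μ • v

/-- `p` is a stable hyperbolic fixed point of `ẋ = f(x)`. -/
def IsStableHyperbolic {n : ℕ} (f : (Fin n → ℝ) → (Fin n → ℝ)) (p : Fin n → ℝ) : Prop :=
  f p = 0 ∧ ∀ μ : ℂ, IsEigenvalue (jacobian f p) μ → μ.re < 0

/-- The real number `l` is the dominant eigenvalue of `A`: every other complex eigenvalue has
strictly smaller real part. -/
def IsDominantEigenvalue {n : ℕ} (A : Matrix (Fin n) (Fin n) ℝ) (l : ℝ) : Prop :=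
  IsEigenvalue A (l : ℂ) ∧ ∀ μ : ℂ, IsEigenvalue A μ → μ ≠ (l : ℂ) → μ.re < l

/-- The system is monotone on `S`: the flow preserves `≤` between initial states in `S`. -/
def IsMonotoneSystem {n : ℕ} (f : (Fin n → ℝ) → (Fin n → ℝ)) (D S : Set (Fin n → ℝ)) : Prop :=
  ∀ γ η : ℝ → (Fin n → ℝ), IsForwardSolution f D γ → IsForwardSolution f D η →
    γ 0 ∈ S → η 0 ∈ S → γ 0 ≤ η 0 → ∀ t, 0 ≤ t → γ t ≤ η t

/-- The system is strongly monotone on `S`: it is monotone there, and `x ≺ y` (that is `x ≤ y` and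
`x ≠ y`) implies that the solutions are strictly ordered in every component at each `t > 0`. -/
def IsStronglyMonotoneSystem {n : ℕ} (f : (Fin n → ℝ) → (Fin n → ℝ)) (D S : Set (Fin n → ℝ)) :
    Prop :=
  IsMonotoneSystem f D S ∧
  ∀ γ η : ℝ → (Fin n → ℝ), IsForwardSolution f D γ → IsForwardSolution f D η →
    γ 0 ∈ S → η 0 ∈ S → γ 0 < η 0 → ∀ t, 0 < t → StrongLT (γ t) (η t)

/-- `s` is a Koopman eigenfunction on `B` with eigenvalue `l`: `s(φ(t,x)) = e^{l t} s(x)`.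
Nontriviality is imposed separately, by normalizing the gradient at the fixed point. -/
def IsKoopmanEigenfunction {n : ℕ} (f : (Fin n → ℝ) → (Fin n → ℝ)) (D B : Set (Fin n → ℝ))
    (s : (Fin n → ℝ) → ℝ) (l : ℝ) : Prop :=
  ∀ γ : ℝ → (Fin n → ℝ), IsForwardSolution f D γ → γ 0 ∈ B →
    ∀ t, 0 ≤ t → s (γ t) = Real.exp (l * t) * s (γ 0)

/-- The sublevel set `{x ∈ B : |s x| ≤ α}` for `α ∈ [0, ∞]`; it is `B` itself for `α = ∞`. -/
def sublevel {n : ℕ} (B : Set (Fin n → ℝ)) (s : (Fin n → ℝ) → ℝ) (α : ℝ≥0∞) :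
    Set (Fin n → ℝ) :=
  {x ∈ B | ENNReal.ofReal |s x| ≤ α}

/-- The level set `{x ∈ B : s x = c}`. -/
def levelSet {n : ℕ} (B : Set (Fin n → ℝ)) (s : (Fin n → ℝ) → ℝ) (c : ℝ) : Set (Fin n → ℝ) :=
  {x ∈ B | s x = c}

/-- The isostable `{x ∈ B : |s x| = r}`. -/
def isostable {n : ℕ} (B : Set (Fin n → ℝ)) (s : (Fin n → ℝ) → ℝ) (r : ℝ) : Set (Fin n → ℝ) :=
  {x ∈ B | |s x| = r}

/-- The set of maximal elements of `A`: boundary points `y` such that no `z ≫ y` lies in `A`. -/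
def maxElements {n : ℕ} (A : Set (Fin n → ℝ)) : Set (Fin n → ℝ) :=
  {y ∈ frontier A | ∀ z, StrongLT y z → z ∉ A}

/-- The set of minimal elements of `A`: boundary points `y` such that no `z ≪ y` lies in `A`. -/
def minElements {n : ℕ} (A : Set (Fin n → ℝ)) : Set (Fin n → ℝ) :=
  {y ∈ frontier A | ∀ z, StrongLT z y → z ∉ A}

/-- `S` is an embedded hypersurface (a submanifold of codimension one, without boundary) of class
`C^k`: locally, a `C^k` change of coordinates of the ambient space maps it to a coordinate
hyperplane. For `k = 0` the change of coordinates is a homeomorphism. -/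
def IsHypersurface {n : ℕ} (k : ℕ) (S : Set (Fin n → ℝ)) : Prop :=
  ∀ y ∈ S, ∃ (e : OpenPartialHomeomorph (Fin n → ℝ) (Fin n → ℝ)) (i : Fin n),
    y ∈ e.source ∧ ContDiffOn ℝ k e e.source ∧ ContDiffOn ℝ k e.symm e.target ∧
    ∀ x ∈ e.source, x ∈ S ↔ e x i = 0

end MonotoneSystems

/-! Three facts carry the theorem: the basin is open and order-convex, `s` is increasing on it, and
`s` has no critical point there. Together they give `s x < s y` whenever `x ≪ y` (`lt_of_strongLT`),
since equality would make `s` constant on an order interval with nonempty interior. Hence the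
sublevel sets are order-convex, their boundary inside the basin is the isostable, and small moves
along the diagonal separate minimal from maximal points. Since `l < 0`, `|s|` decays along
trajectories, so each point is joined to the fixed point inside its sublevel set.

Order-convexity of the basin (`ordConnected_basin`): on a segment from `x` to a point of `[x, y]`,
trajectories that start in the basin are squeezed between those of `x` and `y`. Continuous
dependence passes this to limits, so the part of the segment in the basin is closed as well as open.

No critical points (`fderiv_ne_zero_of_mem_basin`): the flow would carry a critical point to
critical points arbitrarily close to the fixed point, where the gradient is nonzero.

Monotonicity of `s` (`monotoneOn_of_simple_dominant`): the difference of two ordered solutions,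
rescaled by `e^{-lt}`, stays nonnegative and asymptotically follows a linear flow converging to the
projection `ξ ↦ w(ξ) v`, where `w` is the derivative of `s` at the fixed point. One positive
component of `v` then forces `s x ≤ s y`.

The topological hypersurfaces come from order alone: the boundary of an order-convex set is locally
a graph over the diagonal direction (`exists_height`). Flows are handled by replacing `f` near a
compact set by a bounded Lipschitz field (`exists_lipschitz_extension`). -/

namespace MonotoneSystems

/-! ### Global flows of bounded Lipschitz fields, and reduction to them near compact sets. -/

section Flow

variable {E : Type*} [NormedAddCommGroup E] [NormedSpace ℝ E]

/-- Gronwall's inequality for two forward solutions of a globally Lipschitz equation. -/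
lemma dist_le_of_forward_solutions {F : E → E} {K : NNReal} (hF : LipschitzWith K F)
    {α β : ℝ → E} (hα : IsIntegralCurveOn α (fun _ => F) (Ici 0))
    (hβ : IsIntegralCurveOn β (fun _ => F) (Ici 0)) {t : ℝ} (ht : 0 ≤ t) :
    dist (α t) (β t) ≤ dist (α 0) (β 0) * Real.exp (K * t) := by
  have key := dist_le_of_trajectories_ODE (v := fun _ => F) (K := K) (a := 0) (b := t)
    (fun _ => hF) (hα.continuousOn.mono Icc_subset_Ici_self)
    (fun s hs => (hα s hs.1).mono (Ici_subset_Ici.2 hs.1))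
    (hβ.continuousOn.mono Icc_subset_Ici_self)
    (fun s hs => (hβ s hs.1).mono (Ici_subset_Ici.2 hs.1)) le_rfl t ⟨ht, le_rfl⟩
  simpa using key

/-- Gronwall's inequality for two global solutions of a globally Lipschitz equation. -/
lemma dist_le_of_global_solutions {F : E → E} {K : NNReal} (hF : LipschitzWith K F)
    {α β : ℝ → E} (hα : IsIntegralCurve α (fun _ => F))
    (hβ : IsIntegralCurve β (fun _ => F)) (t : ℝ) :
    dist (α t) (β t) ≤ dist (α 0) (β 0) * Real.exp (K * |t|) := by
  rcases le_total 0 t with ht | ht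
  · rw [abs_of_nonneg ht]
    exact dist_le_of_forward_solutions hF (hα.isIntegralCurveOn _) (hβ.isIntegralCurveOn _) ht
  · have hF' : LipschitzWith K (fun x => -F x) := by
      intro x y
      simpa [edist_neg_neg] using hF x y
    have rev : ∀ γ : ℝ → E, IsIntegralCurve γ (fun _ => F) →
        IsIntegralCurve (fun r => γ (-r)) (fun _ x => -F x) := by
      intro γ hγ r
      simpa [Function.comp_def] using (hγ (-r)).scomp r (hasDerivAt_neg r)
    have := dist_le_of_forward_solutions hF' ((rev α hα).isIntegralCurveOn _)
      ((rev β hβ).isIntegralCurveOn _) (t := -t) (by linarith)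
    rw [abs_of_nonpos ht]
    simpa using this

/-- A bounded Lipschitz vector field has a global flow. -/
lemma exists_global_flow [CompleteSpace E] {F : E → E} {K L : NNReal} (hF : LipschitzWith K F)
    (hL : ∀ x, ‖F x‖ ≤ L) :
    ∃ Φ : E → ℝ → E, ∀ x, Φ x 0 = x ∧ IsIntegralCurve (Φ x) (fun _ => F) := by
  suffices H : ∀ x, ∃ α : ℝ → E, α 0 = x ∧ IsIntegralCurve α (fun _ => F) by
    choose Φ hΦ using H
    exact ⟨Φ, hΦ⟩
  intro x
  have loc : ∀ N : ℕ, ∃ α : ℝ → E, α 0 = x ∧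
      ∀ t ∈ Icc (-(N + 1 : ℝ)) (N + 1), HasDerivWithinAt α (F (α t)) (Icc (-(N + 1 : ℝ)) (N + 1)) t := by
    intro N
    have h0 : (0 : ℝ) ∈ Icc (-(N + 1 : ℝ)) (N + 1) := by constructor <;> linarith [N.cast_nonneg (α := ℝ)]
    -- Speed at most `L` keeps the solution within `L * (N + 1)` of `x` for time `N + 1`, so
    -- Picard–Lindelöf applies on the whole interval.
    have hp : IsPicardLindelof (fun _ => F) (⟨0, h0⟩ : Icc (-(N + 1 : ℝ)) (N + 1)) x
        (L * (N + 1)) 0 L K :=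
      { lipschitzOnWith := fun _ _ => hF.lipschitzOnWith
        continuousOn := fun _ _ => continuousOn_const
        norm_le := fun _ _ y _ => hL y
        mul_max_le := by simp }
    exact hp.exists_eq_forall_mem_Icc_hasDerivWithinAt₀
  choose α hα0 hα using loc
  have hαd : ∀ N : ℕ, ∀ t ∈ Ioo (-(N + 1 : ℝ)) (N + 1), HasDerivAt (α N) (F (α N t)) t :=
    fun N t ht => (hα N t (Ioo_subset_Icc_self ht)).hasDerivAt (Icc_mem_nhds ht.1 ht.2)
  have agree : ∀ N M : ℕ, N ≤ M → ∀ t ∈ Ioo (-(N + 1 : ℝ)) (N + 1), α N t = α M t := by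
    intro N M hNM
    have hNM' : (N : ℝ) ≤ M := by exact_mod_cast hNM
    refine ODE_solution_unique_of_mem_Ioo (v := fun _ => F) (s := fun _ => univ) (K := K)
      (t₀ := 0) (fun _ _ => hF.lipschitzOnWith)
      ⟨by linarith [N.cast_nonneg (α := ℝ)], by linarith [N.cast_nonneg (α := ℝ)]⟩
      (fun t ht => ⟨hαd N t ht, trivial⟩)
      (fun t ht => ⟨hαd M t ⟨by linarith [ht.1], by linarith [ht.2]⟩, trivial⟩) ?_
    rw [hα0, hα0]
  refine ⟨fun t => α ⌈|t|⌉₊ t, by simp [hα0], fun t => ?_⟩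
  have mem : ∀ r : ℝ, r ∈ Ioo (-((⌈|r|⌉₊ : ℝ) + 1)) ((⌈|r|⌉₊ : ℝ) + 1) := fun r => by
    have := Nat.le_ceil |r|
    constructor <;> linarith [neg_abs_le r, le_abs_self r]
  -- The index jumps as `r` varies, but near `t` it is at most `⌈|t|⌉₊ + 1`, so this single solution
  -- represents the glued curve there.
  have hev : (fun r => α ⌈|r|⌉₊ r) =ᶠ[𝓝 t] α (⌈|t|⌉₊ + 1) := by
    have : ∀ᶠ r in 𝓝 t, |r| < (⌈|t|⌉₊ : ℝ) + 1 :=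
      (continuous_abs.tendsto t).eventually (gt_mem_nhds (by linarith [Nat.le_ceil |t|]))
    filter_upwards [this] with r hr
    refine agree _ _ ?_ r (mem r)
    exact Nat.ceil_le.2 (by push_cast; exact hr.le)
  refine HasDerivAt.congr_of_eventuallyEq ?_ hev
  have h1 := hev.eq_of_nhds
  show HasDerivAt (α (⌈|t|⌉₊ + 1)) (F (α ⌈|t|⌉₊ t)) t
  rw [h1]
  refine hαd _ t ?_
  have := mem t
  push_cast
  exact ⟨by linarith [this.1], by linarith [this.2]⟩

/-- Solutions of a Lipschitz equation satisfy the group law. -/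
lemma flow_comp {F : E → E} {K : NNReal} (hF : LipschitzWith K F) {Φ : E → ℝ → E}
    (hΦ : ∀ x, Φ x 0 = x ∧ IsIntegralCurve (Φ x) (fun _ => F)) (x : E) (r t : ℝ) :
    Φ (Φ x r) t = Φ x (t + r) := by
  have h := dist_le_of_global_solutions hF (hΦ (Φ x r)).2 ((hΦ x).2.comp_add r) t
  rw [(hΦ _).1] at h
  simpa using h

lemma flow_lipschitz {F : E → E} {K : NNReal} (hF : LipschitzWith K F) {Φ : E → ℝ → E}
    (hΦ : ∀ x, Φ x 0 = x ∧ IsIntegralCurve (Φ x) (fun _ => F)) (x y : E) (t : ℝ) :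
    dist (Φ x t) (Φ y t) ≤ dist x y * Real.exp (K * |t|) := by
  have h := dist_le_of_global_solutions hF (hΦ x).2 (hΦ y).2 t
  rwa [(hΦ _).1, (hΦ _).1] at h

lemma flow_continuous {F : E → E} {K : NNReal} (hF : LipschitzWith K F) {Φ : E → ℝ → E}
    (hΦ : ∀ x, Φ x 0 = x ∧ IsIntegralCurve (Φ x) (fun _ => F)) (t : ℝ) :
    Continuous fun x => Φ x t := by
  have : LipschitzWith (Real.toNNReal (Real.exp (K * |t|))) fun x => Φ x t :=
    LipschitzWith.of_dist_le_mul fun x y => by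
      rw [Real.coe_toNNReal _ (Real.exp_pos _).le, mul_comm]
      exact flow_lipschitz hF hΦ x y t
  exact this.continuous

/-- A `C¹` vector field agrees near a compact subset of its domain with a bounded Lipschitz
vector field on the whole space. -/
lemma exists_lipschitz_extension [FiniteDimensional ℝ E] {f : E → E} {D C : Set E}
    (hD : IsOpen D) (hf : ContDiffOn ℝ 1 f D) (hC : IsCompact C) (hCD : C ⊆ D) :
    ∃ (F : E → E) (U : Set E) (K L : NNReal), LipschitzWith K F ∧ (∀ x, ‖F x‖ ≤ L) ∧
      IsOpen U ∧ C ⊆ U ∧ U ⊆ D ∧ EqOn F f U := by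
  obtain ⟨C', hC', hCC', hC'D⟩ := exists_compact_between hC hD hCD
  obtain ⟨χ, hχ1, hχ0, -⟩ := exists_contMDiffMap_one_nhds_of_subset_interior
    (modelWithCornersSelf ℝ E) (n := 1) hC.isClosed hCC'
  have hχ : ContDiff ℝ 1 χ := χ.contMDiff.contDiff
  have hFs : Function.support (fun x => χ x • f x) ⊆ C' :=
    fun x hx => by_contra fun h => hx (by simp [hχ0 x h])
  have hF : ContDiff ℝ 1 (fun x => χ x • f x) := by
    rw [contDiff_iff_contDiffAt]
    intro x
    by_cases hx : x ∈ D
    · exact hχ.contDiffAt.smul (hf.contDiffAt (hD.mem_nhds hx))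
    -- Outside `D` nothing is known of `f`, but the cutoff vanishes near such a point.
    · have : (fun x => χ x • f x) =ᶠ[𝓝 x] fun _ => 0 := by
        filter_upwards [hC'.isClosed.isOpen_compl.mem_nhds (fun h => hx (hC'D h))] with y hy
        simp [hχ0 y hy]
      exact contDiffAt_const.congr_of_eventuallyEq this
  have hFc : HasCompactSupport (fun x => χ x • f x) := HasCompactSupport.of_support_subset_isCompact hC' hFs
  obtain ⟨K, hK⟩ := hF.lipschitzWith_of_hasCompactSupport hFc one_ne_zero
  obtain ⟨L, hL⟩ := hFc.exists_bound_of_continuous hF.continuous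
  obtain ⟨V, hVo, hCV, hV⟩ := mem_nhdsSet_iff_exists.1 hχ1
  refine ⟨_, V ∩ D, K, L.toNNReal, hK, fun x => (hL x).trans (Real.le_coe_toNNReal L),
    hVo.inter hD, subset_inter hCV hCD, inter_subset_right, fun x hx => ?_⟩
  have : χ x = 1 := hV hx.1
  simp [this]

end Flow

/-! ### Convergence and decay of matrix exponentials read off from the spectrum. -/

section LinearFlow

open NormedSpace

variable {V : Type*} [NormedAddCommGroup V] [NormedSpace ℂ V] [FiniteDimensional ℂ V]

/-- Split `t A = t μ + t N` with commuting summands; `N ^ k` kills `u`, so the exponential series of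
`t N` terminates on it. -/
lemma exp_smul_apply_of_pow_eq_zero (A : V →L[ℂ] V) (μ : ℂ) (u : V) (k : ℕ)
    (hu : ((A - μ • 1 : V →L[ℂ] V) ^ k) u = 0) (t : ℝ) :
    exp (t • A) u = Complex.exp (t * μ) •
      ∑ j ∈ Finset.range k, ((t : ℂ) ^ j / j.factorial) • ((A - μ • 1 : V →L[ℂ] V) ^ j) u := by
  have hc : CompleteSpace V := FiniteDimensional.complete ℂ V
  set N : V →L[ℂ] V := A - μ • 1 with hN
  have h1 : t • A = ((t : ℂ) * μ) • (1 : V →L[ℂ] V) + (t : ℂ) • N := by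
    rw [hN, smul_sub, smul_smul, add_sub_cancel, Complex.coe_smul]
  have h2 : exp (((t : ℂ) * μ) • (1 : V →L[ℂ] V)) = Complex.exp (t * μ) • (1 : V →L[ℂ] V) := by
    have := algebraMap_exp_comm (𝕂 := ℂ) (𝔸 := V →L[ℂ] V) ((t : ℂ) * μ)
    rw [Algebra.algebraMap_eq_smul_one, Algebra.algebraMap_eq_smul_one] at this
    rw [← this, Complex.exp_eq_exp_ℂ]
  let _ : NormedAlgebra ℚ (V →L[ℂ] V) := NormedAlgebra.restrictScalars ℚ ℂ _
  have hcomm : Commute (((t : ℂ) * μ) • (1 : V →L[ℂ] V)) ((t : ℂ) • N) :=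
    (Commute.one_left _).smul_left _
  rw [h1, exp_add_of_commute hcomm, h2]
  simp only [smul_mul_assoc, one_mul, _root_.smul_apply]
  congr 1
  have hs := (exp_series_hasSum_exp' (𝕂 := ℂ) ((t : ℂ) • N)).mapL (ContinuousLinearMap.apply ℂ V u)
  refine hs.unique ?_
  have hz : ∀ j ∉ Finset.range k, (ContinuousLinearMap.apply ℂ V u)
      (((j.factorial : ℂ)⁻¹) • ((t : ℂ) • N) ^ j) = 0 := by
    intro j hj
    obtain ⟨m, rfl⟩ := Nat.exists_eq_add_of_le (not_lt.1 (fun h => hj (Finset.mem_range.2 h)))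
    have : (N ^ (k + m)) u = 0 := by
      rw [add_comm, pow_add, mul_apply_eq_comp, hu, map_zero]
    simp [smul_pow, this]
  have hsum := hasSum_sum_of_ne_finset_zero (L := SummationFilter.unconditional ℕ) hz
  convert hsum using 1
  refine Finset.sum_congr rfl fun j _ => ?_
  simp [smul_pow, mul_smul, div_eq_inv_mul]
  rw [← Complex.ofReal_pow, Complex.coe_smul]

lemma tendsto_exp_smul_apply_zero (A : V →L[ℂ] V) {μ : ℂ} (hμ : μ.re < 0) {u : V}
    (hu : u ∈ Module.End.maxGenEigenspace (A : V →ₗ[ℂ] V) μ) :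
    Tendsto (fun t : ℝ => exp (t • A) u) atTop (𝓝 0) := by
  obtain ⟨k, hk⟩ := (Module.End.mem_maxGenEigenspace _ _ _).1 hu
  have hk' : ((A - μ • 1 : V →L[ℂ] V) ^ k) u = 0 := by
    rw [← hk]
    have : (((A - μ • 1 : V →L[ℂ] V) ^ k : V →L[ℂ] V) : V →ₗ[ℂ] V)
        = ((A : V →ₗ[ℂ] V) - μ • 1) ^ k := by
      rw [ContinuousLinearMap.toLinearMap_pow]; rfl
    rw [← this]; rfl
  simp_rw [exp_smul_apply_of_pow_eq_zero A μ u k hk', Finset.smul_sum, smul_smul]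
  rw [show (0 : V) = ∑ j ∈ Finset.range k, (0 : V) by simp]
  refine tendsto_finsetSum _ fun j _ => ?_
  rw [← zero_smul ℂ (((A - μ • 1 : V →L[ℂ] V) ^ j) u)]
  refine Tendsto.smul_const ?_ _
  rw [tendsto_zero_iff_norm_tendsto_zero]
  have h := (tendsto_rpow_mul_exp_neg_mul_atTop_nhds_zero (j : ℝ) (-μ.re) (by linarith)).mul_const
    ((j.factorial : ℝ)⁻¹)
  rw [zero_mul] at h
  refine h.congr' ?_
  filter_upwards [eventually_ge_atTop 0] with t ht
  simp [Complex.norm_exp, abs_of_nonneg ht]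
  ring_nf

/-- If every eigenvalue of `A` has negative real part, except possibly for one whose generalized
eigenspace lies in `S ≤ ker A`, then the linear flow of `A` converges pointwise to elements
of `S`. -/
lemma exists_tendsto_exp_smul_apply (A : V →L[ℂ] V) (S : Submodule ℂ V) (hS : ∀ u ∈ S, A u = 0)
    (hA : ∀ μ, Module.End.HasEigenvalue (A : V →ₗ[ℂ] V) μ →
      μ.re < 0 ∨ Module.End.maxGenEigenspace (A : V →ₗ[ℂ] V) μ ≤ S) (u : V) :
    ∃ w ∈ S, Tendsto (fun t : ℝ => exp (t • A) u) atTop (𝓝 w) := by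
  -- The vectors with a limit in `S` form a subspace, so it suffices that it contains the
  -- generalized eigenspaces, which span `V` over `ℂ`.
  let P : Submodule ℂ V :=
    { carrier := {u | ∃ w ∈ S, Tendsto (fun t : ℝ => exp (t • A) u) atTop (𝓝 w)}
      add_mem' := by
        rintro a b ⟨w, hw, h⟩ ⟨w', hw', h'⟩
        exact ⟨w + w', S.add_mem hw hw', by simpa using h.add h'⟩
      zero_mem' := ⟨0, S.zero_mem, by simp⟩
      smul_mem' := by
        rintro c a ⟨w, hw, h⟩
        exact ⟨c • w, S.smul_mem c hw, by simpa using h.const_smul c⟩ }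
  suffices h : (⊤ : Submodule ℂ V) ≤ P from h trivial
  rw [← Module.End.iSup_maxGenEigenspace_eq_top (A : V →ₗ[ℂ] V)]
  refine iSup_le fun μ => ?_
  by_cases hμ : Module.End.HasEigenvalue (A : V →ₗ[ℂ] V) μ
  · rcases hA μ hμ with h | h
    · exact fun a ha => ⟨0, S.zero_mem, tendsto_exp_smul_apply_zero A h ha⟩
    · intro a ha
      refine ⟨a, h ha, ?_⟩
      have : ∀ t : ℝ, exp (t • A) a = a := fun t => by
        have := exp_smul_apply_of_pow_eq_zero A 0 a 1 (by simp [hS a (h ha)]) t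
        simpa using this
      simp [this]
  · have : Module.End.maxGenEigenspace (A : V →ₗ[ℂ] V) μ = ⊥ := by
      by_contra hne
      have hne' : Module.End.HasUnifEigenvalue (A : V →ₗ[ℂ] V) μ ⊤ := hne
      exact hμ (hne'.lt one_pos)
    rw [this]
    exact bot_le

lemma continuous_exp_smul (A : V →L[ℂ] V) : Continuous fun t : ℝ => exp (t • A) := by
  have hc : CompleteSpace V := FiniteDimensional.complete ℂ V
  exact continuous_iff_continuousAt.2 fun t => (hasDerivAt_exp_smul_const A t).continuousAt

/-- A pointwise convergent linear flow is uniformly bounded in positive time. -/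
lemma exists_norm_exp_smul_le (A : V →L[ℂ] V)
    (hA : ∀ u, ∃ w, Tendsto (fun t : ℝ => exp (t • A) u) atTop (𝓝 w)) :
    ∃ C, 1 ≤ C ∧ ∀ t : ℝ, 0 ≤ t → ‖exp (t • A)‖ ≤ C := by
  have hc : CompleteSpace V := FiniteDimensional.complete ℂ V
  have := banach_steinhaus (g := fun t : Ici (0 : ℝ) => exp ((t : ℝ) • A)) fun u => by
    obtain ⟨w, hw⟩ := hA u
    obtain ⟨T, hT⟩ := eventually_atTop.1 (hw.norm.eventually (gt_mem_nhds (lt_add_one ‖w‖)))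
    obtain ⟨M, hM⟩ := (isCompact_Icc (a := (0 : ℝ)) (b := T)).exists_bound_of_continuousOn
      (f := fun t : ℝ => exp (t • A) u)
      (((continuous_exp_smul A).clm_apply continuous_const).continuousOn)
    refine ⟨max M (‖w‖ + 1), fun t => ?_⟩
    rcases le_total (t : ℝ) T with h | h
    · exact (hM t ⟨t.2, h⟩).trans (le_max_left _ _)
    · exact (hT t h).le.trans (le_max_right _ _)
  obtain ⟨C, hC⟩ := this
  exact ⟨max 1 C, le_max_left _ _, fun t ht => (hC ⟨t, ht⟩).trans (le_max_right _ _)⟩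

/-- A linear system all of whose eigenvalues have negative real part decays exponentially. -/
lemma exists_norm_exp_smul_le_exp (A : V →L[ℂ] V)
    (hA : ∀ μ, Module.End.HasEigenvalue (A : V →ₗ[ℂ] V) μ → μ.re < 0) :
    ∃ C b, 1 ≤ C ∧ 0 < b ∧ ∀ t : ℝ, 0 ≤ t → ‖exp (t • A)‖ ≤ C * Real.exp (-(2 * b) * t) := by
  have hc : CompleteSpace V := FiniteDimensional.complete ℂ V
  have hfin : {μ | Module.End.HasEigenvalue (A : V →ₗ[ℂ] V) μ}.Finite := Module.End.finite_hasEigenvalue _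
  obtain ⟨b, hb, hbA⟩ : ∃ b > 0, ∀ μ, Module.End.HasEigenvalue (A : V →ₗ[ℂ] V) μ → μ.re < -(2 * b) := by
    have : ∀ᶠ b : ℝ in 𝓝[>] 0, ∀ μ ∈ {μ | Module.End.HasEigenvalue (A : V →ₗ[ℂ] V) μ}, μ.re < -(2 * b) := by
      rw [hfin.eventually_all]
      intro μ hμ
      have : Tendsto (fun b : ℝ => -(2 * b)) (𝓝 0) (𝓝 (-(2 * 0))) := (by fun_prop : Continuous fun b : ℝ => -(2 * b)).tendsto 0
      exact (this.eventually (lt_mem_nhds (by simpa using hA μ hμ))).filter_mono nhdsWithin_le_nhds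
    obtain ⟨b, hb, hb'⟩ := (this.and self_mem_nhdsWithin).exists
    exact ⟨b, hb', hb⟩
  -- The shift by `2 * b` stays inside the spectral gap, so the flow of `B` is still bounded;
  -- undoing the shift gives the decay rate.
  set B : V →L[ℂ] V := A + ((2 * b : ℝ) : ℂ) • 1 with hB
  have hBA : ∀ μ, Module.End.HasEigenvalue (B : V →ₗ[ℂ] V) μ → μ.re < 0 := fun μ hμ => by
    have : Module.End.HasEigenvalue (A : V →ₗ[ℂ] V) (μ - ((2 * b : ℝ) : ℂ)) := by
      obtain ⟨x, hx⟩ := hμ.exists_hasEigenvector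
      refine Module.End.hasEigenvalue_of_hasEigenvector (x := x)
        (Module.End.hasEigenvector_iff.2 ⟨?_, hx.2⟩)
      have h := hx.apply_eq_smul
      rw [Module.End.mem_eigenspace_iff, sub_smul, ← h]
      simp [hB]
    have := hbA _ this
    simp only [Complex.sub_re, Complex.ofReal_re] at this
    linarith
  obtain ⟨C, hC1, hC⟩ := exists_norm_exp_smul_le B fun u =>
    (exists_tendsto_exp_smul_apply B ⊥ (by simp) (fun μ hμ => Or.inl (hBA μ hμ)) u).imp
      fun _ h => h.2
  refine ⟨C, b, hC1, hb, fun t ht => ?_⟩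
  have h1 : t • A = ((-(2 * b) * t : ℝ) : ℂ) • (1 : V →L[ℂ] V) + t • B := by
    rw [hB, smul_add, ← Complex.coe_smul t, ← Complex.coe_smul t, smul_smul]
    rw [add_comm, add_assoc, ← add_smul]
    have : (t : ℂ) * ((2 * b : ℝ) : ℂ) + ((-(2 * b) * t : ℝ) : ℂ) = 0 := by push_cast; ring
    rw [this, zero_smul, add_zero]
  have h2 : exp (((-(2 * b) * t : ℝ) : ℂ) • (1 : V →L[ℂ] V)) = ((Real.exp (-(2 * b) * t) : ℝ) : ℂ) • (1 : V →L[ℂ] V) := by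
    have := algebraMap_exp_comm (𝕂 := ℂ) (𝔸 := V →L[ℂ] V) ((-(2 * b) * t : ℝ) : ℂ)
    rw [Algebra.algebraMap_eq_smul_one, Algebra.algebraMap_eq_smul_one] at this
    rw [← this, ← Complex.exp_eq_exp_ℂ, Complex.ofReal_exp]
  let _ : NormedAlgebra ℚ (V →L[ℂ] V) := NormedAlgebra.restrictScalars ℚ ℂ _
  rw [h1, exp_add_of_commute ((Commute.one_left _).smul_left _), h2, smul_mul_assoc, one_mul,
    norm_smul, Complex.norm_real, Real.norm_eq_abs, Real.abs_exp, mul_comm]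
  exact mul_le_mul_of_nonneg_right (hC t ht) (Real.exp_pos _).le

end LinearFlow

/-! ### Variation of constants and stability under small perturbations. -/

section Duhamel

open NormedSpace

variable {V : Type*} [NormedAddCommGroup V] [NormedSpace ℂ V] [FiniteDimensional ℂ V]

/-- Variation of constants: a curve stays close to the linear flow if its derivative does. -/
lemma norm_sub_exp_smul_apply_le (A : V →L[ℂ] V) {y y' : ℝ → V} {G g : ℝ → ℝ} {t₀ t₁ : ℝ}
    (h01 : t₀ ≤ t₁) (hy : ∀ r ∈ Icc t₀ t₁, HasDerivWithinAt y (y' r) (Icc t₀ t₁) r)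
    (hG : ∀ r, HasDerivAt G (g r) r)
    (hg : ∀ r ∈ Ico t₀ t₁, ‖exp ((t₁ - r) • A)‖ * ‖y' r - A (y r)‖ ≤ g r) :
    ‖y t₁ - exp ((t₁ - t₀) • A) (y t₀)‖ ≤ G t₁ - G t₀ := by
  have hc : CompleteSpace V := FiniteDimensional.complete ℂ V
  have hE : ∀ r, HasDerivAt (fun r : ℝ => exp ((t₁ - r) • A)) (-(exp ((t₁ - r) • A) * A)) r := by
    intro r
    have := (hasDerivAt_exp_smul_const A (t₁ - r)).scomp r ((hasDerivAt_id r).const_sub t₁)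
    simpa [Function.comp_def] using this
  -- The linear part cancels: only the deviation `y' - A y` contributes to this derivative.
  have hd : ∀ r ∈ Icc t₀ t₁, HasDerivWithinAt (fun r => exp ((t₁ - r) • A) (y r))
      (exp ((t₁ - r) • A) (y' r - A (y r))) (Icc t₀ t₁) r := by
    intro r hr
    have hE' : HasDerivAt (fun r : ℝ => (exp ((t₁ - r) • A)).restrictScalars ℝ)
        ((-(exp ((t₁ - r) • A) * A)).restrictScalars ℝ) r :=
      (ContinuousLinearMap.restrictScalarsL ℂ V V ℝ ℝ).hasFDerivAt.comp_hasDerivAt r (hE r)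
    have := hE'.hasDerivWithinAt.clm_apply (hy r hr)
    refine this.congr_deriv ?_
    simp [sub_eq_add_neg, add_comm]
  have hd' : ∀ r ∈ Ico t₀ t₁, HasDerivWithinAt
      (fun r => exp ((t₁ - r) • A) (y r) - exp ((t₁ - t₀) • A) (y t₀))
      (exp ((t₁ - r) • A) (y' r - A (y r))) (Ici r) r := fun r hr =>
    (((hd r ⟨hr.1, hr.2.le⟩).mono_of_mem_nhdsWithin (Icc_mem_nhdsGE_of_mem hr))).sub_const _
  have := image_norm_le_of_norm_deriv_right_le_deriv_boundary (B := fun r => G r - G t₀) (B' := g)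
    (f := fun r => exp ((t₁ - r) • A) (y r) - exp ((t₁ - t₀) • A) (y t₀)) (a := t₀) (b := t₁)
    (fun r hr => ((hd r hr).continuousWithinAt.sub continuousWithinAt_const)) hd' (by simp)
    (fun r => (hG r).sub_const _)
    (fun r hr => ((exp ((t₁ - r) • A)).le_opNorm _).trans (hg r hr)) (right_mem_Icc.2 h01)
  simpa using this

/-- Linearized stability, as an a priori estimate on forward curves. -/
lemma norm_le_exp_of_linearly_stable (A : V →L[ℂ] V) {C b : ℝ} (hC : 1 ≤ C) (hb : 0 < b)
    (hA : ∀ t : ℝ, 0 ≤ t → ‖exp (t • A)‖ ≤ C * Real.exp (-(2 * b) * t))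
    {ε δ : ℝ} (hε0 : 0 ≤ ε) (hε : 2 * C * ε ≤ b) {y y' : ℝ → V}
    (hy : ∀ t ∈ Ici (0 : ℝ), HasDerivWithinAt y (y' t) (Ici 0) t)
    (hy' : ∀ t, 0 ≤ t → ‖y t‖ ≤ δ → ‖y' t - A (y t)‖ ≤ ε * ‖y t‖)
    (h0 : 2 * C * ‖y 0‖ < δ) {t : ℝ} (ht : 0 ≤ t) :
    ‖y t‖ ≤ 2 * C * ‖y 0‖ * Real.exp (-b * t) := by
  have hcont : ContinuousOn y (Ici 0) := fun r hr => (hy r hr).continuousWithinAt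
  have bound : ∀ T, 0 ≤ T → (∀ r ∈ Icc 0 T, ‖y r‖ ≤ δ) →
      ‖y T‖ ≤ 2 * C * ‖y 0‖ * Real.exp (-b * T) := by
    intro T hT hδ
    -- Duhamel is applied at the point where `e^{br} ‖y r‖` attains its maximum `S`. This gives `S ≤
    -- C ‖y 0‖ + C ε S / b`, and `2 C ε ≤ b` absorbs the last term into `S / 2`.
    obtain ⟨m, hm, hmax⟩ := (isCompact_Icc (a := (0 : ℝ)) (b := T)).exists_isMaxOn
      (nonempty_Icc.2 hT) (f := fun r => Real.exp (b * r) * ‖y r‖)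
      ((by fun_prop : Continuous fun r : ℝ => Real.exp (b * r)).continuousOn.mul
        (hcont.mono Icc_subset_Ici_self).norm)
    set S := Real.exp (b * m) * ‖y m‖ with hS
    have hS0 : 0 ≤ S := by positivity
    have hyS : ∀ r ∈ Icc 0 T, ‖y r‖ ≤ S * Real.exp (-b * r) := by
      intro r hr
      have h1 : Real.exp (b * r) * ‖y r‖ ≤ S := hmax hr
      have h2 : Real.exp (b * r) * Real.exp (-b * r) = 1 := by rw [← Real.exp_add]; simp
      calc ‖y r‖ = (Real.exp (b * r) * ‖y r‖) * Real.exp (-b * r) := by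
            rw [mul_right_comm, h2, one_mul]
        _ ≤ _ := by gcongr
    have hm0 : 0 ≤ m := hm.1
    have key := norm_sub_exp_smul_apply_le A (y := y) (y' := y') (t₀ := 0) (t₁ := m)
      (G := fun r => C * ε * S * Real.exp (-(2 * b) * m) * (Real.exp (b * r) / b))
      (g := fun r => C * ε * S * Real.exp (-(2 * b) * m) * Real.exp (b * r)) hm0
      (fun r hr => (hy r hr.1).mono Icc_subset_Ici_self)
      (fun r => by
        have := (((hasDerivAt_id r).const_mul b).exp.div_const b).const_mul
          (C * ε * S * Real.exp (-(2 * b) * m))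
        refine this.congr_deriv ?_
        simp only [id, mul_one]
        field_simp)
      (fun r hr => by
        have hrT : r ∈ Icc 0 T := ⟨hr.1, hr.2.le.trans hm.2⟩
        have e1 := hA (m - r) (by linarith [hr.2])
        have e2 : ‖y' r - A (y r)‖ ≤ ε * (S * Real.exp (-b * r)) :=
          (hy' r hr.1 (hδ r hrT)).trans (mul_le_mul_of_nonneg_left (hyS r hrT) hε0)
        have e3 : Real.exp (-(2 * b) * (m - r)) * Real.exp (-b * r)
            = Real.exp (-(2 * b) * m) * Real.exp (b * r) := by
          rw [← Real.exp_add, ← Real.exp_add]; ring_nf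
        calc _ ≤ (C * Real.exp (-(2 * b) * (m - r))) * (ε * (S * Real.exp (-b * r))) := by gcongr
          _ = C * ε * S * (Real.exp (-(2 * b) * (m - r)) * Real.exp (-b * r)) := by ring
          _ = _ := by rw [e3]; ring)
    have e4 : ‖exp ((m - 0) • A) (y 0)‖ ≤ C * Real.exp (-b * m) * ‖y 0‖ := by
      refine ((exp ((m - 0) • A)).le_opNorm _).trans ?_
      gcongr
      refine (hA _ (by simpa using hm0)).trans ?_
      have : -(2 * b) * (m - 0) ≤ -b * m := by nlinarith
      gcongr
    have e5 : ‖y m‖ ≤ C * Real.exp (-b * m) * ‖y 0‖ + C * ε * S / b * Real.exp (-b * m) := by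
      have h1 : ‖y m‖ ≤ ‖y m - exp ((m - 0) • A) (y 0)‖ + ‖exp ((m - 0) • A) (y 0)‖ := by
        simpa using norm_add_le (y m - exp ((m - 0) • A) (y 0)) (exp ((m - 0) • A) (y 0))
      have h2 : C * ε * S * Real.exp (-(2 * b) * m) * (Real.exp (b * m) / b)
          = C * ε * S / b * Real.exp (-b * m) := by
        have : Real.exp (-b * m) = Real.exp (-(2 * b) * m) * Real.exp (b * m) := by
          rw [← Real.exp_add]; ring_nf
        rw [this]; ring
      have h3 : 0 ≤ C * ε * S * Real.exp (-(2 * b) * m) * (Real.exp (b * 0) / b) := by positivity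
      linarith
    have e6 : S ≤ C * ‖y 0‖ + C * ε * S / b := by
      have h2 : Real.exp (b * m) * Real.exp (-b * m) = 1 := by rw [← Real.exp_add]; simp
      calc S ≤ Real.exp (b * m) * (C * Real.exp (-b * m) * ‖y 0‖
              + C * ε * S / b * Real.exp (-b * m)) := by rw [hS] at *; gcongr
        _ = (Real.exp (b * m) * Real.exp (-b * m)) * (C * ‖y 0‖ + C * ε * S / b) := by ring
        _ = _ := by rw [h2, one_mul]
    have e7 : C * ε * S / b ≤ S / 2 := by
      rw [div_le_iff₀ hb]
      nlinarith
    have e8 : S ≤ 2 * C * ‖y 0‖ := by linarith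
    exact (hyS T ⟨hT, le_rfl⟩).trans (by gcongr)
  have hexp : ∀ T, 0 ≤ T → Real.exp (-b * T) ≤ 1 := fun T hT => by
    rw [Real.exp_le_one_iff]; nlinarith
  have hδ : 0 < δ := lt_of_le_of_lt (by positivity) h0
  -- Continuation: as long as the curve is in the `δ`-ball, `bound` puts it strictly inside, so it
  -- cannot leave.
  have stay : ∀ T, 0 ≤ T → Icc 0 T ⊆ {r | ‖y r‖ ≤ δ} := by
    intro T hT
    have hclosed : IsClosed ({r | ‖y r‖ ≤ δ} ∩ Icc 0 T) := by
      have := (hcont.mono (Icc_subset_Ici_self : Icc 0 T ⊆ Ici 0)).norm.preimage_isClosed_of_isClosed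
        isClosed_Icc (isClosed_Iic (a := δ))
      rwa [inter_comm] at this
    refine hclosed.Icc_subset_of_forall_mem_nhdsGT_of_Icc_subset ?_ fun r hr hsub => ?_
    · show ‖y 0‖ ≤ δ
      nlinarith [norm_nonneg (y 0)]
    have h1 : ‖y r‖ < δ := by
      refine (bound r hr.1 hsub).trans_lt (lt_of_le_of_lt ?_ h0)
      exact mul_le_of_le_one_right (by positivity) (hexp r hr.1)
    have h2 : Tendsto (fun q => ‖y q‖) (𝓝[>] r) (𝓝 ‖y r‖) :=
      ((hcont r hr.1).mono (Ioi_subset_Ici hr.1)).norm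
    exact (h2.eventually (gt_mem_nhds h1)).mono fun _ h => h.le
  exact bound t ht (stay t ht)

end Duhamel

/-- The inclusion of `ℝⁿ` into `ℂⁿ`. -/
noncomputable def complexify (n : ℕ) : (Fin n → ℝ) →L[ℝ] (Fin n → ℂ) :=
  ContinuousLinearMap.pi fun i => Complex.ofRealCLM.comp (ContinuousLinearMap.proj i)

/-- The continuous linear map of `ℂⁿ` given by a real matrix. -/
noncomputable def complexMap {n : ℕ} (M : Matrix (Fin n) (Fin n) ℝ) :
    (Fin n → ℂ) →L[ℂ] (Fin n → ℂ) :=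
  LinearMap.toContinuousLinearMap (M.map Complex.ofReal).mulVecLin

/-! ### Linearized stability at the fixed point, with the Jacobian acting on `ℂⁿ`. -/

section LocalStability

variable {n : ℕ}

@[simp] lemma complexify_apply (x : Fin n → ℝ) (i : Fin n) : complexify n x i = (x i : ℂ) := rfl

@[simp] lemma norm_complexify (x : Fin n → ℝ) : ‖complexify n x‖ = ‖x‖ := by
  simp [Pi.norm_def]

lemma complexMap_complexify (M : Matrix (Fin n) (Fin n) ℝ) (x : Fin n → ℝ) :
    complexMap M (complexify n x) = complexify n (M.mulVec x) := by
  ext i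
  simp [complexMap, Matrix.mulVec, dotProduct]

lemma hasEigenvalue_complexMap_iff (M : Matrix (Fin n) (Fin n) ℝ) (μ : ℂ) :
    Module.End.HasEigenvalue (complexMap M : (Fin n → ℂ) →ₗ[ℂ] (Fin n → ℂ)) μ ↔
      IsEigenvalue M μ := by
  constructor
  · intro h
    obtain ⟨x, hx⟩ := h.exists_hasEigenvector
    exact ⟨x, hx.2, hx.apply_eq_smul⟩
  · rintro ⟨x, hx, h⟩
    exact Module.End.hasEigenvalue_of_hasEigenvector
      (Module.End.hasEigenvector_iff.2 ⟨Module.End.mem_eigenspace_iff.2 h, hx⟩)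

lemma jacobian_mulVec (f : (Fin n → ℝ) → (Fin n → ℝ)) (p x : Fin n → ℝ) :
    (jacobian f p).mulVec x = fderiv ℝ f p x := by
  rw [jacobian, LinearMap.toMatrix'_mulVec]
  rfl

/-- A `C²` map differs from its linearization by a quadratic remainder. -/
lemma exists_norm_sub_fderiv_le {E : Type*} [NormedAddCommGroup E] [NormedSpace ℝ E]
    {f : E → E} {D : Set E} {p : E} (hD : IsOpen D) (hf : ContDiffOn ℝ 2 f D) (hp : p ∈ D) :
    ∃ K δ, 0 ≤ K ∧ 0 < δ ∧ Metric.closedBall p δ ⊆ D ∧ ∀ r ≤ δ,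
      ∀ a ∈ Metric.closedBall p r, ∀ b ∈ Metric.closedBall p r,
        ‖f a - f b - fderiv ℝ f p (a - b)‖ ≤ K * r * ‖a - b‖ := by
  have h2 : ContDiffAt ℝ 1 (fderiv ℝ f) p :=
    (hf.contDiffAt (hD.mem_nhds hp)).fderiv_right (by norm_num)
  obtain ⟨K, t, ht, hK⟩ := h2.exists_lipschitzOnWith
  obtain ⟨δ, hδ, hδt⟩ := Metric.nhds_basis_closedBall.mem_iff.1 (inter_mem ht (hD.mem_nhds hp))
  refine ⟨K, δ, K.2, hδ, fun x hx => (hδt hx).2, fun r hr a ha b hb => ?_⟩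
  have hsub : Metric.closedBall p r ⊆ Metric.closedBall p δ := Metric.closedBall_subset_closedBall hr
  -- On the ball of radius `r` the derivative differs from that at `p` by at most `K * r`. Keeping
  -- the factor `r` makes the error integrable along exponentially converging solutions.
  refine (convex_closedBall p r).norm_image_sub_le_of_norm_hasFDerivWithin_le'
    (f' := fderiv ℝ f) (fun x hx => ?_) (fun x hx => ?_) hb ha
  · have hxD : x ∈ D := (hδt (hsub hx)).2
    exact ((hf.differentiableOn (by norm_num)).differentiableAt
      (hD.mem_nhds hxD)).hasFDerivAt.hasFDerivWithinAt
  · have := hK.dist_le_mul x (hδt (hsub hx)).1 p (mem_of_mem_nhds ht)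
    rw [dist_eq_norm] at this
    exact this.trans (mul_le_mul_of_nonneg_left hx K.2)

/-- Exponential attraction near a stable hyperbolic fixed point. -/
lemma exists_local_stability {f : (Fin n → ℝ) → (Fin n → ℝ)} {D : Set (Fin n → ℝ)}
    {p : Fin n → ℝ} (hD : IsOpen D) (hf : ContDiffOn ℝ 2 f D) (hp : p ∈ D)
    (hst : IsStableHyperbolic f p) :
    ∃ C b δ, 1 ≤ C ∧ 0 < b ∧ 0 < δ ∧ Metric.closedBall p δ ⊆ D ∧
      ∀ y y' : ℝ → (Fin n → ℝ), (∀ t ∈ Ici (0 : ℝ), HasDerivWithinAt y (y' t) (Ici 0) t) →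
        (∀ t, 0 ≤ t → y t ∈ Metric.closedBall p δ → y' t = f (y t)) → 2 * C * ‖y 0 - p‖ < δ →
        ∀ t, 0 ≤ t → ‖y t - p‖ ≤ 2 * C * ‖y 0 - p‖ * Real.exp (-b * t) := by
  obtain ⟨C, b, hC, hb, hA⟩ := exists_norm_exp_smul_le_exp (complexMap (jacobian f p))
    fun μ hμ => hst.2 μ ((hasEigenvalue_complexMap_iff _ _).1 hμ)
  obtain ⟨K, δ₀, hK, hδ₀, hball, hquad⟩ := exists_norm_sub_fderiv_le hD hf hp
  -- On the `δ`-ball the nonlinearity has relative size `K * δ`, which plays the role of `ε`.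
  obtain ⟨δ, hδ, hδ1, hδ2⟩ : ∃ δ > 0, δ ≤ δ₀ ∧ 2 * C * (K * δ) ≤ b := by
    refine ⟨min δ₀ (b / (2 * C * (K + 1))), by positivity, min_le_left _ _, ?_⟩
    have h1 : min δ₀ (b / (2 * C * (K + 1))) ≤ b / (2 * C * (K + 1)) := min_le_right _ _
    calc 2 * C * (K * min δ₀ (b / (2 * C * (K + 1))))
        ≤ 2 * C * ((K + 1) * (b / (2 * C * (K + 1)))) := by gcongr; linarith
      _ = b := by field_simp
  refine ⟨C, b, δ, hC, hb, hδ, (Metric.closedBall_subset_closedBall hδ1).trans hball, ?_⟩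
  intro y y' hy hy' h0 t ht
  have key := norm_le_exp_of_linearly_stable (complexMap (jacobian f p)) hC hb hA
    (ε := K * δ) (δ := δ) (by positivity) hδ2 (y := fun t => complexify n (y t - p))
    (y' := fun t => complexify n (y' t))
    (fun r hr => (complexify n).hasFDerivAt.comp_hasDerivWithinAt r ((hy r hr).sub_const p))
    (fun r hr hrδ => by
      rw [norm_complexify] at hrδ
      have hmem : y r ∈ Metric.closedBall p δ := by rwa [mem_closedBall_iff_norm]
      rw [complexMap_complexify, ← map_sub, norm_complexify, norm_complexify, jacobian_mulVec,
        hy' r hr hmem]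
      have := hquad δ hδ1 (y r) hmem p (Metric.mem_closedBall_self hδ.le)
      rwa [hst.1, sub_zero] at this)
    (by simpa only [norm_complexify] using h0) ht
  simpa only [norm_complexify] using key

end LocalStability

/-! ### Openness of the basin, and absence of critical points of the eigenfunction. -/

section Basin

variable {n : ℕ} {f : (Fin n → ℝ) → (Fin n → ℝ)} {D : Set (Fin n → ℝ)} {p : Fin n → ℝ}

lemma IsForwardSolution.comp_add {γ : ℝ → (Fin n → ℝ)} (hγ : IsForwardSolution f D γ) {T : ℝ}
    (hT : 0 ≤ T) : IsForwardSolution f D (fun t => γ (t + T)) := by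
  refine ⟨fun t ht => hγ.1 _ (by linarith), fun t ht => ?_⟩
  have := (hγ.2.comp_add T).mono (s' := Ici 0) (fun r hr => ?_)
  · exact this t ht
  · simp only [mem_Ici] at hr
    exact mem_vadd_set.2 ⟨r + T, by simp only [mem_Ici]; linarith, by simp⟩

lemma mem_basin_of_forward {γ : ℝ → (Fin n → ℝ)} (hγ : IsForwardSolution f D γ)
    (hlim : Tendsto γ atTop (𝓝 p)) {T : ℝ} (hT : 0 ≤ T) : γ T ∈ basin f D p :=
  ⟨fun t => γ (t + T), hγ.comp_add hT, by simp, hlim.comp (tendsto_atTop_add_const_right _ _ tendsto_id)⟩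

lemma isForwardSolution_const (hp : p ∈ D) (h0 : f p = 0) :
    IsForwardSolution f D (fun _ => p) :=
  ⟨fun _ _ => hp, fun t _ => by simpa [h0] using hasDerivWithinAt_const t (Ici 0) p⟩

lemma self_mem_basin (hp : p ∈ D) (h0 : f p = 0) : p ∈ basin f D p :=
  ⟨fun _ => p, isForwardSolution_const hp h0, rfl, tendsto_const_nhds⟩

/-- Near a point of the basin, the forward solutions are given by the flow of a globally
Lipschitz vector field. -/
lemma exists_flow_near (hD : IsOpen D) (hf : ContDiffOn ℝ 2 f D) (hp : p ∈ D)
    (hst : IsStableHyperbolic f p) {x : Fin n → ℝ} (hx : x ∈ basin f D p) :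
    ∃ (F : (Fin n → ℝ) → (Fin n → ℝ)) (K : NNReal) (Φ : (Fin n → ℝ) → ℝ → (Fin n → ℝ)),
      LipschitzWith K F ∧ (∀ z, Φ z 0 = z ∧ IsIntegralCurve (Φ z) (fun _ => F)) ∧
      ∀ᶠ z in 𝓝 x, IsForwardSolution f D (Φ z) ∧ Tendsto (Φ z) atTop (𝓝 p) := by
  obtain ⟨C, b, δ, hC, hb, hδ, hball, hstab⟩ := exists_local_stability hD hf hp hst
  obtain ⟨γ, hγ, rfl, hlim⟩ := hx
  have hlim' : Tendsto (fun t => 2 * C * ‖γ t - p‖) atTop (𝓝 0) := by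
    have := (tendsto_iff_norm_sub_tendsto_zero.1 hlim).const_mul (2 * C)
    simpa using this
  obtain ⟨T, hT0, hT⟩ : ∃ T, 0 ≤ T ∧ ∀ t ≥ T, 2 * C * ‖γ t - p‖ < δ := by
    obtain ⟨T, hT⟩ := eventually_atTop.1 (hlim'.eventually (gt_mem_nhds hδ))
    exact ⟨max T 0, le_max_right _ _, fun t ht => hT t ((le_max_left _ _).trans ht)⟩
  have hcomp : IsCompact (γ '' Icc 0 T) :=
    isCompact_Icc.image_of_continuousOn (hγ.2.continuousOn.mono Icc_subset_Ici_self)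
  -- The orbit up to time `T` together with the stability ball contains the whole forward orbit;
  -- nearby solutions stay close to the arc by Gronwall, then in the ball.
  obtain ⟨F, U, K, L, hF, hL, hU, hCU, hUD, hFf⟩ := exists_lipschitz_extension hD
    (hf.of_le (by norm_num)) (hcomp.union (isCompact_closedBall p δ))
    (union_subset (by rintro _ ⟨t, ht, rfl⟩; exact hγ.1 t ht.1) hball)
  obtain ⟨Φ, hΦ⟩ := exists_global_flow hF hL
  have hγU : ∀ t, 0 ≤ t → γ t ∈ U := by
    intro t ht
    rcases le_total t T with h | h
    · exact hCU (Or.inl ⟨t, ⟨ht, h⟩, rfl⟩)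
    · refine hCU (Or.inr (mem_closedBall_iff_norm.2 ?_))
      nlinarith [hT t h, norm_nonneg (γ t - p)]
  have hγF : IsIntegralCurveOn γ (fun _ => F) (Ici 0) := fun t ht => by
    simpa only [hFf (hγU t ht)] using hγ.2 t ht
  have hΦγ : ∀ t, 0 ≤ t → Φ (γ 0) t = γ t := by
    intro t ht
    have := dist_le_of_forward_solutions hF ((hΦ (γ 0)).2.isIntegralCurveOn _) hγF ht
    rw [(hΦ _).1] at this
    simpa using this
  obtain ⟨ρ, hρ, hρU⟩ := hcomp.exists_thickening_subset_open hU (subset_union_left.trans hCU)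
  refine ⟨F, K, Φ, hF, hΦ, ?_⟩
  have ev1 : ∀ᶠ z in 𝓝 (γ 0), dist z (γ 0) * Real.exp (K * T) < ρ := by
    have : Tendsto (fun z => dist z (γ 0) * Real.exp (K * T)) (𝓝 (γ 0)) (𝓝 (dist (γ 0) (γ 0) * Real.exp (K * T))) :=
      (by fun_prop : Continuous fun z => dist z (γ 0) * Real.exp (K * T)).tendsto _
    exact this.eventually (gt_mem_nhds (by simpa using hρ))
  have ev2 : ∀ᶠ z in 𝓝 (γ 0), 2 * C * ‖Φ z T - p‖ < δ := by
    have hcont := flow_continuous hF hΦ T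
    have : Tendsto (fun z => 2 * C * ‖Φ z T - p‖) (𝓝 (γ 0)) (𝓝 (2 * C * ‖Φ (γ 0) T - p‖)) :=
      (by fun_prop : Continuous fun z => 2 * C * ‖Φ z T - p‖).tendsto _
    exact this.eventually (gt_mem_nhds (by rw [hΦγ T hT0]; exact hT T le_rfl))
  filter_upwards [ev1, ev2] with z hz1 hz2
  -- `Φ` solves the equation of `f` only where `F = f`; inside the ball is all that `hstab` asks.
  have htail := hstab (fun t => Φ z (t + T)) (fun t => F (Φ z (t + T)))
    (fun t _ => ((hΦ z).2.comp_add T t).hasDerivWithinAt)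
    (fun t _ hmem => hFf (hCU (Or.inr hmem))) (by simpa using hz2)
  simp only [zero_add] at htail
  have hzU : ∀ t, 0 ≤ t → Φ z t ∈ U := by
    intro t ht
    rcases le_total t T with h | h
    · refine hρU (Metric.mem_thickening_iff.2 ⟨γ t, ⟨t, ⟨ht, h⟩, rfl⟩, ?_⟩)
      have h1 := flow_lipschitz hF hΦ z (γ 0) t
      rw [hΦγ t ht, abs_of_nonneg ht] at h1
      refine h1.trans_lt (lt_of_le_of_lt ?_ hz1)
      gcongr
    · refine hCU (Or.inr (mem_closedBall_iff_norm.2 ?_))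
      have h1 := htail (t - T) (by linarith)
      rw [sub_add_cancel] at h1
      refine h1.trans (le_trans (mul_le_of_le_one_right (by positivity) ?_) hz2.le)
      rw [Real.exp_le_one_iff]
      nlinarith
  refine ⟨⟨fun t ht => hUD (hzU t ht), fun t ht => ?_⟩, ?_⟩
  · simpa only [hFf (hzU t ht)] using ((hΦ z).2 t).hasDerivWithinAt (s := Ici 0)
  · have h1 : Tendsto (fun t => Φ z (t + T)) atTop (𝓝 p) := by
      rw [tendsto_iff_norm_sub_tendsto_zero]
      refine squeeze_zero' (Eventually.of_forall fun _ => norm_nonneg _)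
        ((eventually_ge_atTop 0).mono htail) ?_
      have : Tendsto (fun t : ℝ => Real.exp (-b * t)) atTop (𝓝 0) :=
        Real.tendsto_exp_atBot.comp (tendsto_id.const_mul_atTop_of_neg (by linarith))
      simpa using this.const_mul (2 * C * ‖Φ z T - p‖)
    have h2 := h1.comp (tendsto_atTop_add_const_right atTop (-T) tendsto_id)
    refine h2.congr fun t => ?_
    simp

lemma isOpen_basin (hD : IsOpen D) (hf : ContDiffOn ℝ 2 f D) (hp : p ∈ D)
    (hst : IsStableHyperbolic f p) : IsOpen (basin f D p) := by
  rw [isOpen_iff_mem_nhds]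
  intro x hx
  obtain ⟨F, K, Φ, -, hΦ, hev⟩ := exists_flow_near hD hf hp hst hx
  filter_upwards [hev] with z hz
  exact ⟨Φ z, hz.1, (hΦ z).1, hz.2⟩

/-- A Koopman eigenfunction with nonzero gradient at the fixed point has no critical point
in the basin. -/
lemma fderiv_ne_zero_of_mem_basin (hD : IsOpen D) (hf : ContDiffOn ℝ 2 f D) (hp : p ∈ D)
    (hst : IsStableHyperbolic f p) {s : (Fin n → ℝ) → ℝ} {l : ℝ}
    (hsC : ContDiffOn ℝ 1 s (basin f D p)) (hs : IsKoopmanEigenfunction f D (basin f D p) s l)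
    (hsp : fderiv ℝ s p ≠ 0) {x : Fin n → ℝ} (hx : x ∈ basin f D p) : fderiv ℝ s x ≠ 0 := by
  intro hx0
  have hB := isOpen_basin hD hf hp hst
  have hdiff : ∀ z ∈ basin f D p, DifferentiableAt ℝ s z := fun z hz =>
    (hsC.differentiableOn one_ne_zero).differentiableAt (hB.mem_nhds hz)
  have hcont : ContinuousAt (fderiv ℝ s) p :=
    (hsC.continuousOn_fderiv_of_isOpen hB le_rfl).continuousAt
      (hB.mem_nhds (self_mem_basin hp hst.1))
  obtain ⟨F, K, Φ, hF, hΦ, hev⟩ := exists_flow_near hD hf hp hst hx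
  have hxΦ := hev.self_of_nhds
  obtain ⟨t, ht, ht0⟩ : ∃ t, fderiv ℝ s (Φ x t) ≠ 0 ∧ 0 ≤ t :=
    (((hcont.tendsto.comp hxΦ.2).eventually_ne hsp).and (eventually_ge_atTop 0)).exists
  apply ht
  have hψx : Φ (Φ x t) (-t) = x := by
    rw [flow_comp hF hΦ, neg_add_cancel, (hΦ x).1]
  have hψ : Tendsto (fun y => Φ y (-t)) (𝓝 (Φ x t)) (𝓝 x) := by
    have := (flow_continuous hF hΦ (-t)).tendsto (Φ x t)
    rwa [hψx] at this
  -- Near `Φ x t`, `s` is a multiple of `s` composed with the backward flow. That flow is Lipschitz,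
  -- which suffices to transport `s z - s x = o(z - x)`; its differentiability is not needed.
  have hsψ : ∀ᶠ y in 𝓝 (Φ x t), s y = Real.exp (l * t) * s (Φ y (-t)) := by
    filter_upwards [hψ.eventually hev, hψ.eventually (hB.mem_nhds hx)] with y hy hyB
    have h := hs (Φ (Φ y (-t))) hy.1 (by rw [(hΦ _).1]; exact hyB) t ht0
    rwa [(hΦ _).1, flow_comp hF hΦ, add_neg_cancel, (hΦ y).1] at h
  have hlit : (fun z => s z - s x) =o[𝓝 x] fun z => z - x := by
    have := (hdiff x hx).hasFDerivAt.isLittleO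
    simpa [hx0] using this
  have hbig : (fun y => Φ y (-t) - x) =O[𝓝 (Φ x t)] fun y => y - Φ x t := by
    refine Asymptotics.IsBigO.of_bound (Real.exp (K * |(-t)|)) (Eventually.of_forall fun y => ?_)
    have := flow_lipschitz hF hΦ y (Φ x t) (-t)
    rwa [hψx, dist_eq_norm, dist_eq_norm, mul_comm] at this
  have h1 : (fun y => s y - s (Φ x t)) =o[𝓝 (Φ x t)] fun y => y - Φ x t := by
    have h2 := ((hlit.comp_tendsto hψ).trans_isBigO hbig).const_mul_left (Real.exp (l * t))
    refine h2.congr' ?_ EventuallyEq.rfl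
    filter_upwards [hsψ] with y hy
    have h3 := hsψ.self_of_nhds
    rw [hψx] at h3
    rw [hy, h3, Function.comp_apply]
    ring
  have : HasFDerivAt s (0 : (Fin n → ℝ) →L[ℝ] ℝ) (Φ x t) :=
    HasFDerivAt.of_isLittleO (by simpa using h1)
  exact this.fderiv

end Basin

/-- The curve on `[0, 1]` obtained from a curve on `[0, ∞)` by the reparametrization
`r ↦ r / (1 - r)`, with the value `p` at the end point. -/
noncomputable def compactifiedCurve {E : Type*} (γ : ℝ → E) (p : E) (r : ℝ) : E :=
  if r < 1 then γ (r / (1 - r)) else p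

lemma continuousOn_compactifiedCurve {E : Type*} [TopologicalSpace E] {γ : ℝ → E} {p : E}
    (hγ : ContinuousOn γ (Ici 0)) (hlim : Tendsto γ atTop (𝓝 p)) :
    ContinuousOn (compactifiedCurve γ p) (Icc 0 1) := by
  intro r hr
  rcases lt_or_eq_of_le hr.2 with h | rfl
  · have hc : ContinuousOn (fun q : ℝ => γ (q / (1 - q))) (Ico 0 1) := by
      refine hγ.comp (ContinuousOn.div continuousOn_id (by fun_prop) ?_) ?_
      · intro q hq; linarith [hq.2]
      · intro q hq; exact div_nonneg hq.1 (by linarith [hq.2])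
    have h1 := hc r ⟨hr.1, h⟩
    have hIco : ContinuousWithinAt (compactifiedCurve γ p) (Ico 0 1) r :=
      h1.congr (fun q hq => if_pos hq.2) (if_pos h)
    refine hIco.mono_of_mem_nhdsWithin ?_
    filter_upwards [self_mem_nhdsWithin, mem_nhdsWithin_of_mem_nhds (gt_mem_nhds h)] with q hq hq'
    exact ⟨hq.1, hq'⟩
  · have h1 : compactifiedCurve γ p 1 = p := if_neg (lt_irrefl _)
    rw [ContinuousWithinAt, h1, show Icc (0 : ℝ) 1 = insert 1 (Ico 0 1) by
      rw [← Ico_union_right zero_le_one, union_comm]; rfl, nhdsWithin_insert, tendsto_sup]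
    refine ⟨by rw [tendsto_pure_left]; intro s hs; rw [h1]; exact mem_of_mem_nhds hs, ?_⟩
    have h2 : Tendsto (fun q : ℝ => q / (1 - q)) (𝓝[Ico 0 1] 1) atTop := by
      have h3 : Tendsto (fun q : ℝ => 1 - q) (𝓝[Ico 0 1] 1) (𝓝[>] 0) := by
        refine tendsto_nhdsWithin_iff.2 ⟨?_, ?_⟩
        · have : Tendsto (fun q : ℝ => 1 - q) (𝓝 1) (𝓝 (1 - 1)) :=
            (by fun_prop : Continuous fun q : ℝ => 1 - q).tendsto 1
          rw [sub_self] at this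
          exact this.mono_left nhdsWithin_le_nhds
        · filter_upwards [self_mem_nhdsWithin] with q hq
          exact sub_pos.2 hq.2
      have h4 := tendsto_inv_nhdsGT_zero.comp h3
      have h5 : Tendsto (fun q : ℝ => q) (𝓝[Ico 0 1] 1) (𝓝 1) := nhdsWithin_le_nhds
      exact h5.pos_mul_atTop one_pos h4
    refine (hlim.comp h2).congr' ?_
    filter_upwards [self_mem_nhdsWithin] with q hq
    exact (if_pos hq.2).symm

/-! ### Order-convexity of the basin and path-connectedness. -/

section Convexity

variable {n : ℕ} {f : (Fin n → ℝ) → (Fin n → ℝ)} {D : Set (Fin n → ℝ)} {p : Fin n → ℝ}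

lemma compactifiedCurve_mem {E : Type*} {γ : ℝ → E} {p : E} {S : Set E}
    (hγ : ∀ t, 0 ≤ t → γ t ∈ S) (hp : p ∈ S) {r : ℝ} (hr : r ∈ Icc (0 : ℝ) 1) :
    compactifiedCurve γ p r ∈ S := by
  unfold compactifiedCurve
  split_ifs with h
  · exact hγ _ (div_nonneg hr.1 (by linarith))
  · exact hp

/-- The order intervals spanned by two ordered curves with a common limit lie in a compact
subset of every order-convex set containing the curves and the limit. -/
lemma exists_isCompact_between {γ η : ℝ → (Fin n → ℝ)} (hD : D.OrdConnected) (hp : p ∈ D)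
    (hγD : ∀ t, 0 ≤ t → γ t ∈ D) (hηD : ∀ t, 0 ≤ t → η t ∈ D)
    (hγ : ContinuousOn γ (Ici 0)) (hη : ContinuousOn η (Ici 0)) (hγp : Tendsto γ atTop (𝓝 p))
    (hηp : Tendsto η atTop (𝓝 p)) (hle : ∀ t, 0 ≤ t → γ t ≤ η t) :
    ∃ C, IsCompact C ∧ C ⊆ D ∧ ∀ t, 0 ≤ t → Icc (γ t) (η t) ⊆ C := by
  set g := compactifiedCurve γ p with hg
  set h := compactifiedCurve η p with hh
  have hgc := continuousOn_compactifiedCurve hγ hγp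
  have hhc := continuousOn_compactifiedCurve hη hηp
  have hgh : ∀ r ∈ Icc (0 : ℝ) 1, g r ≤ h r := by
    intro r hr
    simp only [hg, hh, compactifiedCurve]
    split_ifs with h1
    · exact hle _ (div_nonneg hr.1 (by linarith))
    · exact le_rfl
  -- Componentwise interpolation parametrizes all the order intervals at once by a compact cube.
  let Θ : ℝ × (Fin n → ℝ) → (Fin n → ℝ) := fun q => g q.1 + q.2 * (h q.1 - g q.1)
  have hΘ : ContinuousOn Θ (Icc 0 1 ×ˢ Icc 0 1) := by
    have e1 : ContinuousOn (fun q : ℝ × (Fin n → ℝ) => g q.1) (Icc 0 1 ×ˢ Icc 0 1) :=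
      hgc.comp continuousOn_fst fun q hq => hq.1
    have e2 : ContinuousOn (fun q : ℝ × (Fin n → ℝ) => h q.1) (Icc 0 1 ×ˢ Icc 0 1) :=
      hhc.comp continuousOn_fst fun q hq => hq.1
    exact e1.add (continuousOn_snd.mul (e2.sub e1))
  refine ⟨Θ '' (Icc 0 1 ×ˢ Icc 0 1), (isCompact_Icc.prod isCompact_Icc).image_of_continuousOn hΘ,
    ?_, ?_⟩
  · rintro _ ⟨⟨r, θ⟩, ⟨hr, hθ⟩, rfl⟩
    refine hD.out (compactifiedCurve_mem hγD hp hr) (compactifiedCurve_mem hηD hp hr) ⟨?_, ?_⟩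
    · intro i
      have := mul_nonneg (hθ.1 i) (sub_nonneg.2 (hgh r hr i))
      show g r i ≤ g r i + θ i * (h r i - g r i)
      exact le_add_of_nonneg_right this
    · intro i
      have := mul_le_mul_of_nonneg_right (hθ.2 i) (sub_nonneg.2 (hgh r hr i))
      simp only [Pi.one_apply, one_mul] at this
      simp only [Θ, Pi.add_apply, Pi.mul_apply, Pi.sub_apply]
      linarith
  · intro t ht z hz
    have ht1 : t / (1 + t) < 1 := by rw [div_lt_one (by linarith)]; linarith
    have ht2 : t / (1 + t) / (1 - t / (1 + t)) = t := by field_simp; ring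
    have hgt : g (t / (1 + t)) = γ t := by
      simp only [hg, compactifiedCurve, if_pos ht1, ht2]
    have hht : h (t / (1 + t)) = η t := by
      simp only [hh, compactifiedCurve, if_pos ht1, ht2]
    -- The time `t / (1 + t)` inverts the reparametrization. Where the interval is degenerate the
    -- quotient is `0` by convention, which is harmless since any value works.
    refine ⟨(t / (1 + t), fun i => (z i - γ t i) / (η t i - γ t i)),
      ⟨⟨by positivity, ht1.le⟩, ⟨?_, ?_⟩⟩, ?_⟩
    · intro i
      exact div_nonneg (sub_nonneg.2 (hz.1 i)) (sub_nonneg.2 (hle t ht i))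
    · intro i
      exact div_le_one_of_le₀ (sub_le_sub_right (hz.2 i) _) (sub_nonneg.2 (hle t ht i))
    · ext i
      simp only [Θ, hgt, hht, Pi.add_apply, Pi.mul_apply, Pi.sub_apply]
      rcases eq_or_ne (η t i - γ t i) 0 with h0 | h0
      · have := hz.1 i
        have := hz.2 i
        rw [h0]
        simp only [mul_zero, add_zero]
        linarith
      · field_simp
        ring

lemma tendsto_of_le_of_le {γ η ζ : ℝ → (Fin n → ℝ)} (hγp : Tendsto γ atTop (𝓝 p))
    (hηp : Tendsto η atTop (𝓝 p)) (h1 : ∀ t, 0 ≤ t → γ t ≤ ζ t) (h2 : ∀ t, 0 ≤ t → ζ t ≤ η t) :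
    Tendsto ζ atTop (𝓝 p) := by
  rw [tendsto_pi_nhds] at *
  exact fun i => tendsto_of_tendsto_of_tendsto_of_le_of_le' (hγp i) (hηp i)
    ((eventually_ge_atTop 0).mono fun t ht => h1 t ht i)
    ((eventually_ge_atTop 0).mono fun t ht => h2 t ht i)

/-- Monotonicity does not apply to `z`, which is not yet known to be in the basin. It applies to
approximating points, whose orbits stay in one compact subset of `D`; there a Lipschitz flow gives
continuous dependence, and the squeezing passes to `z`. -/
lemma mem_basin_of_mem_closure (hD : IsOpen D) (hDc : D.OrdConnected) (hf : ContDiffOn ℝ 2 f D)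
    (hp : p ∈ D) (hmon : IsMonotoneSystem f D (basin f D p)) {x y z : Fin n → ℝ}
    (hx : x ∈ basin f D p) (hy : y ∈ basin f D p)
    (hz : z ∈ closure (basin f D p ∩ Icc x y)) : z ∈ basin f D p := by
  obtain ⟨γ, hγ, hγ0, hγp⟩ := id hx
  obtain ⟨η, hη, hη0, hηp⟩ := id hy
  have hxy : x ≤ y := by
    have : z ∈ Icc x y := closure_minimal inter_subset_right isClosed_Icc hz
    exact this.1.trans this.2
  have hle : ∀ t, 0 ≤ t → γ t ≤ η t := hmon γ η hγ hη (by rwa [hγ0]) (by rwa [hη0])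
    (by rwa [hγ0, hη0])
  obtain ⟨C, hC, hCD, hCI⟩ := exists_isCompact_between hDc hp hγ.1 hη.1 hγ.2.continuousOn
    hη.2.continuousOn hγp hηp hle
  obtain ⟨F, U, K, L, hF, hL, hU, hCU, hUD, hFf⟩ := exists_lipschitz_extension hD
    (hf.of_le (by norm_num)) hC hCD
  obtain ⟨Φ, hΦ⟩ := exists_global_flow hF hL
  have hbd : ∀ t, 0 ≤ t → Φ z t ∈ Icc (γ t) (η t) := by
    intro t ht
    have hcl : IsClosed {w | Φ w t ∈ Icc (γ t) (η t)} :=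
      isClosed_Icc.preimage (flow_continuous hF hΦ t)
    refine closure_minimal ?_ hcl hz
    rintro w ⟨hwB, hw⟩
    obtain ⟨ζ, hζ, rfl, -⟩ := id hwB
    have h1 : ∀ r, 0 ≤ r → ζ r ∈ Icc (γ r) (η r) := fun r hr =>
      ⟨hmon γ ζ hγ hζ (by rwa [hγ0]) hwB (by rw [hγ0]; exact hw.1) r hr,
        hmon ζ η hζ hη hwB (by rwa [hη0]) (by rw [hη0]; exact hw.2) r hr⟩
    have h2 : IsIntegralCurveOn ζ (fun _ => F) (Ici 0) := fun r hr => by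
      simpa only [hFf (hCU (hCI r hr (h1 r hr)))] using hζ.2 r hr
    have h3 := dist_le_of_forward_solutions hF ((hΦ (ζ 0)).2.isIntegralCurveOn _) h2 ht
    rw [(hΦ _).1, dist_self, zero_mul] at h3
    have h4 : Φ (ζ 0) t = ζ t := dist_le_zero.1 h3
    show Φ (ζ 0) t ∈ Icc (γ t) (η t)
    rw [h4]
    exact h1 t ht
  refine ⟨Φ z, ⟨fun t ht => hCD (hCI t ht (hbd t ht)), fun t ht => ?_⟩, (hΦ z).1,
    tendsto_of_le_of_le hγp hηp (fun t ht => (hbd t ht).1) (fun t ht => (hbd t ht).2)⟩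
  simpa only [hFf (hCU (hCI t ht (hbd t ht)))] using ((hΦ z).2 t).hasDerivWithinAt (s := Ici 0)

/-- The basin of attraction of a monotone system is order-convex. -/
lemma ordConnected_basin (hD : IsOpen D) (hDc : D.OrdConnected) (hf : ContDiffOn ℝ 2 f D)
    (hp : p ∈ D) (hst : IsStableHyperbolic f p) (hmon : IsMonotoneSystem f D (basin f D p)) :
    (basin f D p).OrdConnected := by
  refine ⟨fun x hx y hy z hz => ?_⟩
  have hB := isOpen_basin hD hf hp hst
  have hIcc : ∀ τ ∈ Icc (0 : ℝ) 1, AffineMap.lineMap x z τ ∈ Icc x y := fun τ hτ =>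
    (convex_Icc x y).lineMap_mem ⟨le_rfl, hz.1.trans hz.2⟩ hz hτ
  have hc : Continuous (AffineMap.lineMap x z : ℝ →ᵃ[ℝ] (Fin n → ℝ)) := AffineMap.lineMap_continuous
  have hsub : Icc (0 : ℝ) 1 ⊆ (AffineMap.lineMap x z : ℝ →ᵃ[ℝ] (Fin n → ℝ)) ⁻¹' basin f D p := by
    -- Along the segment from `x` to `z`, the parameters landing in the basin form a relatively
    -- closed and open set containing `0`.
    refine IsClosed.Icc_subset_of_forall_mem_nhdsWithin ?_ (by simpa using hx) ?_
    · refine isClosed_of_closure_subset fun τ hτ => ?_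
      have h1 : τ ∈ Icc (0 : ℝ) 1 := closure_minimal inter_subset_right isClosed_Icc hτ
      refine ⟨mem_basin_of_mem_closure hD hDc hf hp hmon hx hy ?_, h1⟩
      exact map_mem_closure hc hτ fun q hq => ⟨hq.1, hIcc q hq.2⟩
    · rintro τ ⟨hτ, -⟩
      exact mem_nhdsWithin_of_mem_nhds ((hB.preimage hc).mem_nhds hτ)
  have := hsub (right_mem_Icc.2 zero_le_one)
  simpa using this

/-- Sets containing the fixed point and invariant under the flow in the basin are
path-connected. -/
lemma isPathConnected_of_forward_invariant {S : Set (Fin n → ℝ)} (hSB : S ⊆ basin f D p)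
    (hpS : p ∈ S) (hinv : ∀ γ, IsForwardSolution f D γ → Tendsto γ atTop (𝓝 p) → γ 0 ∈ S →
      ∀ t, 0 ≤ t → γ t ∈ S) : IsPathConnected S := by
  refine ⟨p, hpS, fun {x} hx => ?_⟩
  obtain ⟨γ, hγ, rfl, hlim⟩ := hSB hx
  refine (JoinedIn.ofLine (f := compactifiedCurve γ p)
    (continuousOn_compactifiedCurve hγ.2.continuousOn hlim) ?_ ?_ ?_).symm
  · simp [compactifiedCurve]
  · simp [compactifiedCurve]
  · rintro _ ⟨r, hr, rfl⟩
    exact compactifiedCurve_mem (hinv γ hγ hlim hx) hpS hr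

end Convexity

/-! ### The spectral projection of a simple dominant eigenvalue. -/

section SimpleDominant

open NormedSpace

variable {n : ℕ}

/-- The complex-linear extension of a real functional. -/
noncomputable def complexFunctional (w : (Fin n → ℝ) →L[ℝ] ℝ) : (Fin n → ℂ) →L[ℂ] ℂ :=
  ∑ i, ((w (Pi.single i 1) : ℝ) : ℂ) • ContinuousLinearMap.proj i

lemma complexFunctional_complexify (w : (Fin n → ℝ) →L[ℝ] ℝ) (x : Fin n → ℝ) :
    complexFunctional w (complexify n x) = (w x : ℂ) := by
  have h : w x = ∑ i, x i * w (Pi.single i 1) := by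
    conv_lhs => rw [pi_eq_sum_univ' x]
    simp [map_sum]
  simp [complexFunctional, h, mul_comm]

/-- For a simple dominant eigenvalue, the rescaled linear flow converges to the spectral
projection `ξ ↦ w(ξ) v`. -/
lemma tendsto_exp_of_simple_dominant {J : Matrix (Fin n) (Fin n) ℝ} {l : ℝ}
    (hl : IsDominantEigenvalue J l) (hsimple : J.charpoly.rootMultiplicity l = 1)
    {v : Fin n → ℝ} (hv : J.mulVec v = l • v) {w : (Fin n → ℝ) →L[ℝ] ℝ} (hwv : w v = 1)
    (hw : ∀ h, w (J.mulVec h) = l * w h) :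
    (∀ u, ∃ z, Tendsto (fun t : ℝ => exp (t • (complexMap J - (l : ℂ) • 1)) u) atTop (𝓝 z)) ∧
    ∀ ξ : Fin n → ℝ, Tendsto (fun t : ℝ => exp (t • (complexMap J - (l : ℂ) • 1)) (complexify n ξ))
      atTop (𝓝 ((w ξ : ℂ) • complexify n v)) := by
  set M : (Fin n → ℂ) →L[ℂ] (Fin n → ℂ) := complexMap J - (l : ℂ) • 1 with hM
  have hv0 : complexify n v ≠ 0 := by
    intro h
    have : ‖v‖ = 0 := by rw [← norm_complexify, h, norm_zero]
    rw [norm_eq_zero.1 this, map_zero] at hwv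
    exact zero_ne_one hwv
  have hAv : complexMap J (complexify n v) = (l : ℂ) • complexify n v := by
    rw [complexMap_complexify, hv, map_smul, Complex.coe_smul]
  have hMv : M (complexify n v) = 0 := by simp [hM, hAv]
  have hML : (M : (Fin n → ℂ) →ₗ[ℂ] (Fin n → ℂ)) = (complexMap J : (Fin n → ℂ) →ₗ[ℂ] (Fin n → ℂ)) - (l : ℂ) • 1 := rfl
  -- Root multiplicity is unchanged from `ℝ` to `ℂ`, so the complex generalized eigenspace is the
  -- line through `v`.
  have hrank : Module.finrank ℂ
      (Module.End.maxGenEigenspace (complexMap J : (Fin n → ℂ) →ₗ[ℂ] (Fin n → ℂ)) l) = 1 := by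
    rw [LinearMap.finrank_maxGenEigenspace_eq]
    have h1 : (complexMap J : (Fin n → ℂ) →ₗ[ℂ] (Fin n → ℂ)) = Matrix.toLin' (J.map Complex.ofReal) := rfl
    have h2 : (J.map Complex.ofReal).charpoly = J.charpoly.map Complex.ofRealHom :=
      Matrix.charpoly_map J Complex.ofRealHom
    rw [h1, Matrix.charpoly_toLin', h2, ← hsimple]
    exact (Polynomial.eq_rootMultiplicity_map (f := Complex.ofRealHom) Complex.ofReal_injective l).symm
  have hvmem : complexify n v ∈ Module.End.maxGenEigenspace (complexMap J : (Fin n → ℂ) →ₗ[ℂ] (Fin n → ℂ)) l := by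
    refine (Module.End.mem_maxGenEigenspace _ _ _).2 ⟨1, ?_⟩
    rw [pow_one, ← hML]
    exact hMv
  have hspan : Module.End.maxGenEigenspace (M : (Fin n → ℂ) →ₗ[ℂ] (Fin n → ℂ)) 0 ≤
      Submodule.span ℂ {complexify n v} := by
    rw [hML, ← Module.End.maxGenEigenspace_eq_maxGenEigenspace_zero]
    intro u hu
    obtain ⟨c, hc⟩ := (finrank_eq_one_iff_of_nonzero' (⟨_, hvmem⟩ : Module.End.maxGenEigenspace
      (complexMap J : (Fin n → ℂ) →ₗ[ℂ] (Fin n → ℂ)) l) (by simpa [Subtype.ext_iff] using hv0)).1 hrank ⟨u, hu⟩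
    exact Submodule.mem_span_singleton.2 ⟨c, congrArg Subtype.val hc⟩
  have hconv := exists_tendsto_exp_smul_apply M (Submodule.span ℂ {complexify n v})
    (fun u hu => by
      obtain ⟨c, rfl⟩ := Submodule.mem_span_singleton.1 hu
      rw [map_smul, hMv, smul_zero])
    (fun μ hμ => by
      rcases eq_or_ne μ 0 with rfl | h0
      · exact Or.inr hspan
      · refine Or.inl ?_
        obtain ⟨x, hx⟩ := hμ.exists_hasEigenvector
        have h1 : complexMap J x = (μ + l) • x := by
          have := hx.apply_eq_smul
          simp only [hM, ContinuousLinearMap.coe_coe, _root_.sub_apply, _root_.smul_apply,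
            one_apply_eq_self, sub_eq_iff_eq_add] at this
          rw [this, add_smul]
        have := hl.2 (μ + l) ⟨x, hx.2, h1⟩ (by simpa using h0)
        simpa using this)
  have hωM : ∀ u, complexFunctional w (M u) = 0 := by
    have : (complexFunctional w).toLinearMap ∘ₗ (M : (Fin n → ℂ) →ₗ[ℂ] (Fin n → ℂ)) = 0 := by
      refine (Pi.basisFun ℂ (Fin n)).ext fun i => ?_
      have hb : (Pi.basisFun ℂ (Fin n)) i = complexify n (Pi.single i 1) := by
        ext j
        rw [Pi.basisFun_apply, complexify_apply, Pi.single_apply, Pi.single_apply]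
        split_ifs <;> simp
      rw [hb]
      show complexFunctional w (complexMap J (complexify n (Pi.single i 1)) -
        (l : ℂ) • complexify n (Pi.single i 1)) = 0
      rw [complexMap_complexify, map_sub, map_smul, complexFunctional_complexify,
        complexFunctional_complexify, hw, Complex.ofReal_mul, smul_eq_mul, sub_self]
    exact fun u => LinearMap.congr_fun this u
  -- `w` is conserved by the rescaled flow, which determines the coefficient of `v` in the limit.
  have hωexp : ∀ (t : ℝ) u, complexFunctional w (exp (t • M) u) = complexFunctional w u := by
    intro t u
    have hd : ∀ r : ℝ, HasDerivAt (fun r : ℝ => complexFunctional w (exp (r • M) u)) 0 r := by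
      intro r
      have h1 := hasDerivAt_exp_smul_const' M r
      have h2 := ((((complexFunctional w).comp
        (ContinuousLinearMap.apply ℂ (Fin n → ℂ) u)).restrictScalars ℝ).hasFDerivAt
          (x := exp (r • M))).comp_hasDerivAt r h1
      refine h2.congr_deriv ?_
      simp [hωM]
    have := is_const_of_deriv_eq_zero (fun r => (hd r).differentiableAt) (fun r => (hd r).deriv) t 0
    have h0 : exp ((0 : ℝ) • M) = 1 := by
      rw [show (0 : ℝ) • M = 0 by ext; simp, exp_zero]
    rw [h0] at this
    exact this
  refine ⟨fun u => (hconv u).imp fun _ h => h.2, fun ξ => ?_⟩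
  obtain ⟨z, hz, hlim⟩ := hconv (complexify n ξ)
  obtain ⟨c, rfl⟩ := Submodule.mem_span_singleton.1 hz
  have h1 := ((complexFunctional w).continuous.tendsto _).comp hlim
  have h2 : complexFunctional w (complexify n ξ) = complexFunctional w (c • complexify n v) := by
    refine tendsto_nhds_unique ?_ h1
    simp only [Function.comp_def, hωexp]
    exact tendsto_const_nhds
  rw [map_smul, complexFunctional_complexify, complexFunctional_complexify, hwv] at h2
  have h3 : c = (w ξ : ℂ) := by simpa using h2.symm
  rwa [h3] at hlim

end SimpleDominant

/-! ### The eigenfunction at the fixed point, and exponential convergence. -/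

section Koopman

variable {n : ℕ} {f : (Fin n → ℝ) → (Fin n → ℝ)} {D : Set (Fin n → ℝ)} {p : Fin n → ℝ}
  {s : (Fin n → ℝ) → ℝ} {l : ℝ}

lemma koopman_apply_self (hp : p ∈ D) (hst : IsStableHyperbolic f p)
    (hs : IsKoopmanEigenfunction f D (basin f D p) s l) (hl : l < 0) : s p = 0 := by
  have h := hs _ (isForwardSolution_const hp hst.1) (self_mem_basin hp hst.1) 1 zero_le_one
  have h1 : Real.exp (l * 1) < 1 := by rw [Real.exp_lt_one_iff]; linarith
  have h2 : (1 - Real.exp (l * 1)) * s p = 0 := by linarith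
  rcases mul_eq_zero.1 h2 with h3 | h3
  · linarith
  · exact h3

/-- The eigenfunction identity is differentiated at time `0`, from the right only, as solutions are
given for `t ≥ 0`. -/
lemma fderiv_apply_vectorField (hB : IsOpen (basin f D p))
    (hsC : ContDiffOn ℝ 1 s (basin f D p)) (hs : IsKoopmanEigenfunction f D (basin f D p) s l)
    {x : Fin n → ℝ} (hx : x ∈ basin f D p) : fderiv ℝ s x (f x) = l * s x := by
  obtain ⟨γ, hγ, rfl, -⟩ := id hx
  have hd : DifferentiableAt ℝ s (γ 0) :=
    (hsC.differentiableOn one_ne_zero).differentiableAt (hB.mem_nhds hx)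
  have h1 := hd.hasFDerivAt.comp_hasDerivWithinAt 0 (hγ.2 0 self_mem_Ici)
  have h2 : HasDerivWithinAt (fun t => Real.exp (l * t) * s (γ 0)) (l * s (γ 0)) (Ici 0) 0 := by
    have := (((hasDerivAt_id (0 : ℝ)).const_mul l).exp.mul_const (s (γ 0))).hasDerivWithinAt
      (s := Ici 0)
    simpa using this
  have h3 : HasDerivWithinAt (s ∘ γ) (l * s (γ 0)) (Ici 0) 0 :=
    h2.congr (fun t ht => hs γ hγ hx t ht) (by simp)
  exact (uniqueDiffOn_Ici (0 : ℝ) 0 self_mem_Ici).eq_deriv _ h1 h3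

/-- The gradient of a Koopman eigenfunction at the fixed point is a left eigenvector of the
Jacobian matrix. -/
lemma fderiv_jacobian_mulVec (hD : IsOpen D) (hf : ContDiffOn ℝ 2 f D) (hp : p ∈ D)
    (hst : IsStableHyperbolic f p) (hsC : ContDiffOn ℝ 1 s (basin f D p))
    (hs : IsKoopmanEigenfunction f D (basin f D p) s l) (hl : l < 0) (h : Fin n → ℝ) :
    fderiv ℝ s p ((jacobian f p).mulVec h) = l * fderiv ℝ s p h := by
  have hB := isOpen_basin hD hf hp hst
  have hpB := self_mem_basin hp hst.1
  have hline : HasDerivAt (fun τ : ℝ => p + τ • h) h 0 := by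
    simpa using ((hasDerivAt_id (0 : ℝ)).smul_const h).const_add p
  have hfd : HasDerivAt (fun τ : ℝ => f (p + τ • h)) (fderiv ℝ f p h) 0 := by
    have : DifferentiableAt ℝ f (p + (0 : ℝ) • h) := by
      simpa using (hf.differentiableOn (by norm_num)).differentiableAt (hD.mem_nhds hp)
    simpa [Function.comp_def] using this.hasFDerivAt.comp_hasDerivAt 0 hline
  have hsd : HasDerivAt (fun τ : ℝ => s (p + τ • h)) (fderiv ℝ s p h) 0 := by
    have : DifferentiableAt ℝ s (p + (0 : ℝ) • h) := by
      simpa using (hsC.differentiableOn one_ne_zero).differentiableAt (hB.mem_nhds hpB)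
    simpa [Function.comp_def] using this.hasFDerivAt.comp_hasDerivAt 0 hline
  -- `s` is only `C¹`, so `ds(f) = l s` cannot be differentiated. Instead it is divided by `τ` at `p
  -- + τ h`; since `f p = 0` and `s p = 0`, both sides converge.
  have e1 := hasDerivAt_iff_tendsto_slope_zero.1 hfd
  have e2 := hasDerivAt_iff_tendsto_slope_zero.1 hsd
  simp only [zero_add, zero_smul, add_zero, hst.1, koopman_apply_self hp hst hs hl, sub_zero] at e1 e2
  have hl0 : Tendsto (fun τ : ℝ => p + τ • h) (𝓝[≠] 0) (𝓝 p) := by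
    have := hline.continuousAt.tendsto
    simp only [zero_smul, add_zero] at this
    exact this.mono_left nhdsWithin_le_nhds
  have hcont : ContinuousAt (fderiv ℝ s) p :=
    (hsC.continuousOn_fderiv_of_isOpen hB le_rfl).continuousAt (hB.mem_nhds hpB)
  have e3 := (isBoundedBilinearMap_apply.continuous.tendsto (fderiv ℝ s p, fderiv ℝ f p h)).comp
    ((hcont.tendsto.comp hl0).prodMk_nhds e1)
  have e4 := e2.const_mul l
  rw [jacobian_mulVec]
  refine tendsto_nhds_unique e3 (e4.congr' ?_)
  filter_upwards [hl0.eventually (hB.mem_nhds hpB)] with τ hτ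
  simp only [Function.comp_apply]
  rw [map_smul, fderiv_apply_vectorField hB hsC hs hτ]
  simp only [smul_eq_mul]
  ring

/-- Forward solutions converging to a stable hyperbolic fixed point do so exponentially. -/
lemma exists_exponential_bound (hD : IsOpen D) (hf : ContDiffOn ℝ 2 f D) (hp : p ∈ D)
    (hst : IsStableHyperbolic f p) :
    ∃ b > 0, ∀ γ, IsForwardSolution f D γ → Tendsto γ atTop (𝓝 p) →
      ∃ R, 0 ≤ R ∧ ∀ᶠ t in atTop, ‖γ t - p‖ ≤ R * Real.exp (-b * t) := by
  obtain ⟨C, b, δ, hC, hb, hδ, hball, hstab⟩ := exists_local_stability hD hf hp hst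
  refine ⟨b, hb, fun γ hγ hlim => ?_⟩
  have hlim' : Tendsto (fun t => 2 * C * ‖γ t - p‖) atTop (𝓝 0) := by
    have := (tendsto_iff_norm_sub_tendsto_zero.1 hlim).const_mul (2 * C)
    simpa using this
  obtain ⟨T, hT, hT0⟩ := ((hlim'.eventually (gt_mem_nhds hδ)).and (eventually_ge_atTop 0)).exists
  refine ⟨2 * C * ‖γ T - p‖ * Real.exp (b * T), by positivity, ?_⟩
  filter_upwards [eventually_ge_atTop T] with t ht
  have h := hstab (fun r => γ (r + T)) (fun r => f (γ (r + T))) (hγ.comp_add hT0).2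
    (fun _ _ _ => rfl) (by simpa using hT) (t - T) (by linarith)
  simp only [sub_add_cancel, zero_add] at h
  rw [mul_assoc, ← Real.exp_add]
  convert h using 3
  ring

end Koopman

/-! ### Exponentially decaying perturbations of a bounded linear flow. -/

section AsymptoticallyLinear

open NormedSpace

variable {V : Type*} [NormedAddCommGroup V] [NormedSpace ℂ V] [FiniteDimensional ℂ V]

/-- An exponentially decaying perturbation of a bounded linear flow has bounded solutions, and
these are asymptotic to solutions of the linear equation. -/
lemma exists_bound_of_asymptotically_linear (M : V →L[ℂ] V) {C κ b T : ℝ} (hC : 1 ≤ C)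
    (hκ : 0 ≤ κ) (hb : 0 < b) (hT : 0 ≤ T) (hM : ∀ t : ℝ, 0 ≤ t → ‖exp (t • M)‖ ≤ C)
    {y y' : ℝ → V} (hy : ∀ t ∈ Ici (0 : ℝ), HasDerivWithinAt y (y' t) (Ici 0) t)
    (hy' : ∀ t, T ≤ t → ‖y' t - M (y t)‖ ≤ κ * Real.exp (-b * t) * ‖y t‖) :
    ∃ T' S, 0 ≤ T' ∧ (∀ t, T' ≤ t → ‖y t‖ ≤ S) ∧ ∀ t₀ t, T' ≤ t₀ → t₀ ≤ t →
      ‖y t - exp ((t - t₀) • M) (y t₀)‖ ≤ C * κ * S / b * Real.exp (-b * t₀) := by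
  have hcont : ContinuousOn y (Ici 0) := fun r hr => (hy r hr).continuousWithinAt
  have duh : ∀ t₀ t S, 0 ≤ S → T ≤ t₀ → t₀ ≤ t → (∀ r ∈ Icc t₀ t, ‖y r‖ ≤ S) →
      ‖y t - exp ((t - t₀) • M) (y t₀)‖ ≤ C * κ * S / b * Real.exp (-b * t₀) := by
    intro t₀ t S hS0 hTt₀ ht₀ hS
    have key := norm_sub_exp_smul_apply_le M (y := y) (y' := y') (t₀ := t₀) (t₁ := t)
      (G := fun r => -(C * κ * S / b * Real.exp (-b * r)))
      (g := fun r => C * κ * S * Real.exp (-b * r)) ht₀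
      (fun r hr => (hy r (hT.trans (hTt₀.trans hr.1))).mono
        (Icc_subset_Ici_self.trans (Ici_subset_Ici.2 (hT.trans hTt₀))))
      (fun r => by
        have := ((((hasDerivAt_id r).const_mul (-b)).exp).const_mul (C * κ * S / b)).neg
        refine this.congr_deriv ?_
        simp only [id, mul_one]
        field_simp)
      (fun r hr => by
        have e1 := hM (t - r) (by linarith [hr.2])
        have e2 := hy' r (hTt₀.trans hr.1)
        have e3 := hS r ⟨hr.1, hr.2.le⟩
        calc _ ≤ C * (κ * Real.exp (-b * r) * S) := by
              gcongr
              exact e2.trans (by gcongr)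
          _ = _ := by ring)
    have h0 : 0 ≤ C * κ * S / b * Real.exp (-b * t) := by positivity
    simp only [sub_neg_eq_add] at key
    linarith
  -- After `T'` the accumulated perturbation is at most half the maximum of `‖y‖`, so `duh` applied
  -- at a maximum point bounds `y`.
  obtain ⟨T', hTT', hT'⟩ : ∃ T', T ≤ T' ∧ C * κ / b * Real.exp (-b * T') ≤ 1 / 2 := by
    have : Tendsto (fun t : ℝ => C * κ / b * Real.exp (-b * t)) atTop (𝓝 0) := by
      have := (Real.tendsto_exp_atBot.comp (tendsto_id.const_mul_atTop_of_neg
        (show -b < 0 by linarith))).const_mul (C * κ / b)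
      simpa [Function.comp_def] using this
    obtain ⟨T', h1, h2⟩ := ((this.eventually (gt_mem_nhds (show (0 : ℝ) < 1 / 2 by norm_num))).and
      (eventually_ge_atTop T)).exists
    exact ⟨T', h2, h1.le⟩
  have hbd : ∀ t, T' ≤ t → ‖y t‖ ≤ 2 * C * ‖y T'‖ := by
    intro t ht
    obtain ⟨m, hm, hmax⟩ := (isCompact_Icc (a := T') (b := t)).exists_isMaxOn
      (nonempty_Icc.2 ht) (f := fun r => ‖y r‖)
      ((hcont.mono (Icc_subset_Ici_self.trans (Ici_subset_Ici.2 (hT.trans hTT')))).norm)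
    have e1 := duh T' m ‖y m‖ (norm_nonneg _) hTT' hm.1
      (fun r hr => hmax ⟨hr.1, hr.2.trans hm.2⟩)
    have e2 : ‖exp ((m - T') • M) (y T')‖ ≤ C * ‖y T'‖ :=
      ((exp ((m - T') • M)).le_opNorm _).trans (by gcongr; exact hM _ (by linarith [hm.1]))
    have e3 : ‖y m‖ ≤ ‖y m - exp ((m - T') • M) (y T')‖ + ‖exp ((m - T') • M) (y T')‖ := by
      simpa using norm_add_le (y m - exp ((m - T') • M) (y T')) (exp ((m - T') • M) (y T'))
    have e4 : C * κ * ‖y m‖ / b * Real.exp (-b * T') ≤ 1 / 2 * ‖y m‖ := by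
      calc _ = (C * κ / b * Real.exp (-b * T')) * ‖y m‖ := by ring
        _ ≤ _ := by gcongr
    have e5 : ‖y t‖ ≤ ‖y m‖ := hmax ⟨ht, le_rfl⟩
    linarith
  exact ⟨T', 2 * C * ‖y T'‖, hT.trans hTT', hbd, fun t₀ t ht₀ ht =>
    duh t₀ t _ (by positivity) (hTT'.trans ht₀) ht fun r hr => hbd r (ht₀.trans hr.1)⟩

end AsymptoticallyLinear

/-! ### The eigenfunction is increasing. -/

section Monotonicity

open NormedSpace

variable {n : ℕ} {f : (Fin n → ℝ) → (Fin n → ℝ)} {D : Set (Fin n → ℝ)} {p : Fin n → ℝ}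
  {s : (Fin n → ℝ) → ℝ} {l : ℝ}

/-- The dominant Koopman eigenfunction of a monotone system is increasing if the dominant
eigenvalue is simple. -/
lemma monotoneOn_of_simple_dominant (hD : IsOpen D) (hf : ContDiffOn ℝ 2 f D) (hp : p ∈ D)
    (hst : IsStableHyperbolic f p) (hmon : IsMonotoneSystem f D (basin f D p))
    (hl : IsDominantEigenvalue (jacobian f p) l)
    (hsimple : (jacobian f p).charpoly.rootMultiplicity l = 1)
    {v : Fin n → ℝ} (hv : (jacobian f p).mulVec v = l • v) (hvpos : ∃ i, 0 < v i)
    (hsC : ContDiffOn ℝ 1 s (basin f D p)) (hs : IsKoopmanEigenfunction f D (basin f D p) s l)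
    (hsv : fderiv ℝ s p v = 1) : MonotoneOn s (basin f D p) := by
  intro x hx y hy hxy
  have hl0 : l < 0 := by simpa using hst.2 l hl.1
  have hB := isOpen_basin hD hf hp hst
  have hpB := self_mem_basin hp hst.1
  obtain ⟨i, hi⟩ := hvpos
  obtain ⟨hconv, hlim⟩ := tendsto_exp_of_simple_dominant hl hsimple hv hsv
    (fderiv_jacobian_mulVec hD hf hp hst hsC hs hl0)
  set M : (Fin n → ℂ) →L[ℂ] (Fin n → ℂ) := complexMap (jacobian f p) - (l : ℂ) • 1 with hM
  obtain ⟨C, hC, hCM⟩ := exists_norm_exp_smul_le M hconv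
  obtain ⟨b, hb, hexp⟩ := exists_exponential_bound hD hf hp hst
  obtain ⟨K, δ, hK, hδ, hball, hquad⟩ := exists_norm_sub_fderiv_le hD hf hp
  obtain ⟨γ, hγ, rfl, hγp⟩ := id hx
  obtain ⟨η, hη, rfl, hηp⟩ := id hy
  have hle : ∀ t, 0 ≤ t → γ t ≤ η t := hmon γ η hγ hη hx hy hxy
  obtain ⟨R₁, hR₁, hγR⟩ := hexp γ hγ hγp
  obtain ⟨R₂, hR₂, hηR⟩ := hexp η hη hηp
  set R := R₁ + R₂ with hR
  have hRδ : ∀ᶠ t : ℝ in atTop, R * Real.exp (-b * t) ≤ δ := by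
    have : Tendsto (fun t : ℝ => R * Real.exp (-b * t)) atTop (𝓝 0) := by
      have := (Real.tendsto_exp_atBot.comp (tendsto_id.const_mul_atTop_of_neg
        (show -b < 0 by linarith))).const_mul R
      simpa [Function.comp_def] using this
    exact (this.eventually (gt_mem_nhds hδ)).mono fun _ h => h.le
  obtain ⟨T, hT, hT0⟩ : ∃ T, (∀ t, T ≤ t → ‖γ t - p‖ ≤ R * Real.exp (-b * t) ∧
      ‖η t - p‖ ≤ R * Real.exp (-b * t) ∧ R * Real.exp (-b * t) ≤ δ) ∧ 0 ≤ T := by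
    obtain ⟨T, hT⟩ := eventually_atTop.1 ((hγR.and hηR).and hRδ)
    refine ⟨max T 0, fun t ht => ?_, le_max_right _ _⟩
    obtain ⟨⟨h1, h2⟩, h3⟩ := hT t ((le_max_left _ _).trans ht)
    refine ⟨h1.trans ?_, h2.trans ?_, h3⟩ <;> gcongr <;> linarith
  -- The rescaled difference is nonnegative for `t ≥ 0` and solves `ψ' = (J - l) ψ` up to an error
  -- of relative size `K R e^{-bt}`.
  set ψ : ℝ → (Fin n → ℝ) := fun t => Real.exp (-l * t) • (η t - γ t) with hψ
  set ψ' : ℝ → (Fin n → ℝ) := fun t =>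
    Real.exp (-l * t) • (f (η t) - f (γ t)) - l • ψ t with hψ'
  have hψd : ∀ t ∈ Ici (0 : ℝ), HasDerivWithinAt ψ (ψ' t) (Ici 0) t := by
    intro t ht
    have h1 := (((hasDerivAt_id t).const_mul (-l)).exp).hasDerivWithinAt (s := Ici 0)
    have h2 := h1.smul ((hη.2 t ht).sub (hγ.2 t ht))
    refine h2.congr_deriv ?_
    ext j
    simp only [hψ', hψ, id, mul_one, Pi.add_apply, Pi.sub_apply, Pi.smul_apply, smul_eq_mul]
    ring
  obtain ⟨T', S, hT'0, hS, hasym⟩ := exists_bound_of_asymptotically_linear M hC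
    (κ := K * R) (by positivity) hb hT0 hCM (y := fun t => complexify n (ψ t))
    (y' := fun t => complexify n (ψ' t))
    (fun t ht => (complexify n).hasFDerivAt.comp_hasDerivWithinAt t (hψd t ht))
    (fun t ht => by
      obtain ⟨h1, h2, h3⟩ := hT t ht
      have h4 := hquad _ h3 (η t) (mem_closedBall_iff_norm.2 h2) (γ t) (mem_closedBall_iff_norm.2 h1)
      have h5 : complexify n (ψ' t) - M (complexify n (ψ t)) =
          complexify n (Real.exp (-l * t) • (f (η t) - f (γ t) - fderiv ℝ f p (η t - γ t))) := by
        have : M (complexify n (ψ t)) = complexify n (fderiv ℝ f p (ψ t) - l • ψ t) := by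
          show complexMap (jacobian f p) (complexify n (ψ t)) - (l : ℂ) • complexify n (ψ t) = _
          rw [complexMap_complexify, jacobian_mulVec, map_sub,
            map_smul (complexify n) l (ψ t), Complex.coe_smul]
        have hψf : fderiv ℝ f p (ψ t) = Real.exp (-l * t) • fderiv ℝ f p (η t - γ t) :=
          map_smul _ _ _
        rw [this, hψf, ← map_sub]
        simp only [hψ', sub_sub_sub_cancel_right, smul_sub]
      rw [h5, norm_complexify, norm_complexify, norm_smul, hψ, norm_smul]
      calc _ ≤ ‖Real.exp (-l * t)‖ * (K * (R * Real.exp (-b * t)) * ‖η t - γ t‖) := by gcongr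
        _ = _ := by ring)
  set w := fderiv ℝ s p with hw
  -- Component `i` of `exp (t • M)` applied to `ψ τ` is within the error of `ψ (t + τ) i ≥ 0`, and
  -- tends to `w (ψ τ) * v i` as `t → ∞`.
  have lower : ∀ τ, T' ≤ τ → -(C * (K * R) * S / b * Real.exp (-b * τ)) ≤ w (ψ τ) * v i := by
    intro τ hτ
    have h1 : Tendsto (fun t : ℝ => ((exp (t • M) (complexify n (ψ τ))) i).re) atTop
        (𝓝 (w (ψ τ) * v i)) := by
      have := ((continuous_apply i).tendsto _).comp (hlim (ψ τ))
      have := (Complex.continuous_re.tendsto _).comp this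
      simpa [Function.comp_def] using this
    refine ge_of_tendsto h1 ?_
    filter_upwards [eventually_ge_atTop 0] with t ht
    have h2 := hasym τ (t + τ) hτ (by linarith)
    rw [add_sub_cancel_right] at h2
    have h3 := (Complex.abs_re_le_norm _).trans ((norm_le_pi_norm _ i).trans h2)
    have h4 : 0 ≤ ψ (t + τ) i := by
      have := hle (t + τ) (by linarith) i
      simp only [hψ, Pi.smul_apply, Pi.sub_apply, smul_eq_mul]
      exact mul_nonneg (Real.exp_pos _).le (sub_nonneg.2 this)
    have h5 := (abs_le.1 h3).2
    simp only [Pi.sub_apply, complexify_apply, Complex.sub_re, Complex.ofReal_re] at h5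
    linarith
  -- The difference of the values of `s` along the two solutions is exactly `e^{lτ} (s (η 0) - s (γ
  -- 0))`. Strict differentiability at `p` replaces it by `w (η τ - γ τ)` with error `o(‖η τ - γ
  -- τ‖)`, still small after rescaling because `ψ` is bounded.
  have hwψ : Tendsto (fun τ => w (ψ τ)) atTop (𝓝 (s (η 0) - s (γ 0))) := by
    have hstrict : HasStrictFDerivAt s w p :=
      (hsC.contDiffAt (hB.mem_nhds hpB)).hasStrictFDerivAt one_ne_zero
    have h1 := hstrict.isLittleO.comp_tendsto (hηp.prodMk_nhds hγp)
    rw [tendsto_iff_norm_sub_tendsto_zero, Metric.tendsto_atTop]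
    intro ε hε
    have hS0 : 0 ≤ S := (norm_nonneg _).trans (hS T' le_rfl)
    obtain ⟨T₂, hT₂⟩ := eventually_atTop.1 (h1.bound (show 0 < ε / (S + 1) by positivity))
    refine ⟨max T₂ T', fun τ hτ => ?_⟩
    have hτ0 : 0 ≤ τ := hT'0.trans ((le_max_right _ _).trans hτ)
    have h2 := hT₂ τ ((le_max_left _ _).trans hτ)
    have h3 := hS τ ((le_max_right _ _).trans hτ)
    rw [norm_complexify, hψ, norm_smul] at h3
    simp only [Function.comp_apply] at h2
    rw [hs η hη hy τ hτ0, hs γ hγ hx τ hτ0] at h2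
    have h4 : w (ψ τ) - (s (η 0) - s (γ 0)) = -(Real.exp (-l * τ) *
        (Real.exp (l * τ) * s (η 0) - Real.exp (l * τ) * s (γ 0) - w (η τ - γ τ))) := by
      have : Real.exp (-l * τ) * Real.exp (l * τ) = 1 := by rw [← Real.exp_add]; simp
      have h : w (ψ τ) = Real.exp (-l * τ) * w (η τ - γ τ) := by
        simp only [hψ, map_smul, smul_eq_mul]
      rw [h]
      linear_combination (s (η 0) - s (γ 0)) * this
    rw [Real.dist_0_eq_abs, abs_norm, h4, norm_neg, norm_mul]
    calc _ ≤ ‖Real.exp (-l * τ)‖ * (ε / (S + 1) * ‖η τ - γ τ‖) := by gcongr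
      _ = ε / (S + 1) * (‖Real.exp (-l * τ)‖ * ‖η τ - γ τ‖) := by ring
      _ ≤ ε / (S + 1) * S := by gcongr
      _ < ε := by rw [div_mul_eq_mul_div, div_lt_iff₀ (by positivity)]; nlinarith
  have hfin : 0 ≤ (s (η 0) - s (γ 0)) * v i := by
    have h1 : Tendsto (fun τ : ℝ => -(C * (K * R) * S / b * Real.exp (-b * τ))) atTop (𝓝 0) := by
      have := ((Real.tendsto_exp_atBot.comp (tendsto_id.const_mul_atTop_of_neg
        (show -b < 0 by linarith))).const_mul (C * (K * R) * S / b)).neg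
      simpa [Function.comp_def] using this
    exact le_of_tendsto_of_tendsto h1 (hwψ.mul_const (v i))
      ((eventually_ge_atTop T').mono lower)
  have := nonneg_of_mul_nonneg_left hfin hi
  linarith

end Monotonicity

/-! ### Boundaries of order-convex sets, and level sets as hypersurfaces. -/

section OrderGeometry

variable {n : ℕ} {A : Set (Fin n → ℝ)}

lemma eventually_strongLT_left {x y : Fin n → ℝ} (h : StrongLT x y) :
    ∀ᶠ u in 𝓝 x, StrongLT u y :=
  eventually_all.2 fun i => ((continuous_apply i).tendsto x).eventually (gt_mem_nhds (h i))

lemma eventually_strongLT_right {x y : Fin n → ℝ} (h : StrongLT x y) :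
    ∀ᶠ u in 𝓝 y, StrongLT x u :=
  eventually_all.2 fun i => ((continuous_apply i).tendsto y).eventually (lt_mem_nhds (h i))

lemma exists_strongLT_of_mem_closure {x y : Fin n → ℝ} (hx : x ∈ closure A) (h : StrongLT x y) :
    ∃ a ∈ A, StrongLT a y :=
  let ⟨a, ha, ha'⟩ := ((mem_closure_iff_frequently.1 hx).and_eventually
    (eventually_strongLT_left h)).exists
  ⟨a, ha, ha'⟩

lemma exists_strongGT_of_mem_closure {x y : Fin n → ℝ} (hy : y ∈ closure A) (h : StrongLT x y) :
    ∃ a ∈ A, StrongLT x a :=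
  let ⟨a, ha, ha'⟩ := ((mem_closure_iff_frequently.1 hy).and_eventually
    (eventually_strongLT_right h)).exists
  ⟨a, ha, ha'⟩

lemma not_strongLT_of_mem_minElements {x y : Fin n → ℝ} (hx : x ∈ minElements A)
    (hy : y ∈ minElements A) : ¬ StrongLT y x := fun h =>
  let ⟨a, ha, hax⟩ := exists_strongLT_of_mem_closure (frontier_subset_closure hy.1) h
  hx.2 a hax ha

lemma not_strongLT_of_mem_maxElements {x y : Fin n → ℝ} (hx : x ∈ maxElements A)
    (hy : y ∈ maxElements A) : ¬ StrongLT y x := fun h =>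
  let ⟨a, ha, hax⟩ := exists_strongGT_of_mem_closure (frontier_subset_closure hx.1) h
  hy.2 a hax ha

/-- The boundary of an order-convex set consists of its minimal and maximal elements. -/
lemma frontier_eq_minElements_union_maxElements (hA : A.OrdConnected) :
    frontier A = minElements A ∪ maxElements A := by
  refine Subset.antisymm (fun y hy => ?_) (union_subset (fun _ h => h.1) fun _ h => h.1)
  by_contra hcon
  simp only [minElements, maxElements, mem_union, mem_ofPred_eq, hy, true_and, not_or, not_forall,
    not_not] at hcon
  obtain ⟨⟨a, hay, ha⟩, b, hyb, hb⟩ := hcon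
  refine hy.2 (mem_interior_iff_mem_nhds.2 ?_)
  filter_upwards [eventually_strongLT_right hay, eventually_strongLT_left hyb] with u h1 h2
  exact hA.out ha hb ⟨h1.le, h2.le⟩

lemma isHypersurface_zero_of_homeomorph {S : Set (Fin n → ℝ)}
    (h : ∀ y ∈ S, ∃ (e : OpenPartialHomeomorph (Fin n → ℝ) (Fin n → ℝ)) (i : Fin n),
      y ∈ e.source ∧ ∀ x ∈ e.source, x ∈ S ↔ e x i = 0) : IsHypersurface 0 S := by
  intro y hy
  obtain ⟨e, i, hye, he⟩ := h y hy
  refine ⟨e, i, hye, ?_, ?_, he⟩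
  · rw [Nat.cast_zero, contDiffOn_zero]
    exact e.continuousOn
  · rw [Nat.cast_zero, contDiffOn_zero]
    exact e.continuousOn_symm

/-- The reflection `x ↦ -x` exchanges minimal and maximal elements, so only maximal ones need a
direct argument. -/
lemma isHypersurface_zero_neg {S : Set (Fin n → ℝ)} (h : IsHypersurface 0 (-S)) :
    IsHypersurface 0 S := by
  refine isHypersurface_zero_of_homeomorph fun y hy => ?_
  obtain ⟨e, i, hye, -, -, he⟩ := h (-y) (by simpa using hy)
  refine ⟨(Homeomorph.neg (Fin n → ℝ)).toOpenPartialHomeomorph.trans e, i, by simpa using hye,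
    fun x hx => ?_⟩
  have hx' : -x ∈ e.source := by simpa using hx
  have := he (-x) hx'
  simpa using this

lemma neg_maxElements (A : Set (Fin n → ℝ)) : -maxElements A = minElements (-A) := by
  have hf : frontier (-A) = -frontier A :=
    ((Homeomorph.neg (Fin n → ℝ)).preimage_frontier A).symm
  ext y
  simp only [maxElements, minElements, hf, mem_ofPred_eq, Set.mem_neg]
  refine and_congr_right fun _ => ⟨fun h z hz => ?_, fun h z hz => ?_⟩
  · exact h (-z) fun i => neg_lt_neg (hz i)
  · have := h (-z) fun i => by simpa using neg_lt_neg (hz i)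
    simpa using this

lemma neg_minElements (A : Set (Fin n → ℝ)) : -minElements A = maxElements (-A) := by
  have := neg_maxElements (-A)
  rw [neg_neg] at this
  rw [← this, neg_neg]

/-- The points which lie strictly below some point of `A`. -/
def strictLowerHull (A : Set (Fin n → ℝ)) : Set (Fin n → ℝ) :=
  {u | ∃ a ∈ A, StrongLT u a}

/-- The distance, along the diagonal, to the boundary of the strict lower hull. -/
lemma exists_height {a₀ y₀ : Fin n → ℝ} (ha₀ : a₀ ∈ A) (hy₀ : y₀ ∉ strictLowerHull A) :
    ∃ g : (Fin n → ℝ) → ℝ, Continuous g ∧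
      (∀ u τ, (fun i => u i + τ) ∈ strictLowerHull A ↔ τ < g u) ∧
      ∀ u σ, g (fun i => u i + σ) = g u - σ := by
  have hlow : ∀ u u' : Fin n → ℝ, u ≤ u' → u' ∈ strictLowerHull A → u ∈ strictLowerHull A :=
    fun u u' h ⟨a, ha, hua⟩ => ⟨a, ha, fun i => (h i).trans_lt (hua i)⟩
  -- Far down the diagonal a point lies strictly below `a₀`; far up it dominates `y₀`, which is
  -- outside the hull. So the supremum is finite.
  have hne : ∀ u : Fin n → ℝ, {τ : ℝ | (fun i => u i + τ) ∈ strictLowerHull A}.Nonempty := fun u =>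
    ⟨-(‖u‖ + ‖a₀‖ + 1), a₀, ha₀, fun i => by
      have h1 := (abs_le.1 ((Real.norm_eq_abs _).symm ▸ norm_le_pi_norm u i)).2
      have h2 := (abs_le.1 ((Real.norm_eq_abs _).symm ▸ norm_le_pi_norm a₀ i)).1
      show u i + -(‖u‖ + ‖a₀‖ + 1) < a₀ i
      linarith⟩
  have hbd : ∀ u : Fin n → ℝ, BddAbove {τ : ℝ | (fun i => u i + τ) ∈ strictLowerHull A} := fun u =>
    ⟨‖u‖ + ‖y₀‖, fun τ hτ => by
      by_contra hcon
      refine hy₀ (hlow _ _ (fun i => ?_) hτ)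
      have h1 := (abs_le.1 ((Real.norm_eq_abs _).symm ▸ norm_le_pi_norm u i)).1
      have h2 := (abs_le.1 ((Real.norm_eq_abs _).symm ▸ norm_le_pi_norm y₀ i)).2
      show y₀ i ≤ u i + τ
      linarith⟩
  have key : ∀ (u : Fin n → ℝ) (τ : ℝ), (fun i => u i + τ) ∈ strictLowerHull A ↔
      τ < sSup {τ : ℝ | (fun i => u i + τ) ∈ strictLowerHull A} := by
    intro u τ
    constructor
    · rintro ⟨a, ha, hua⟩
      have hev : ∀ᶠ r in 𝓝 τ, StrongLT (fun i => u i + r) a :=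
        ((by fun_prop : Continuous fun r : ℝ => fun i => u i + r).tendsto τ).eventually
          (eventually_strongLT_left hua)
      obtain ⟨r, hr, hτr⟩ := ((hev.filter_mono nhdsWithin_le_nhds).and
        (self_mem_nhdsWithin : Ioi τ ∈ 𝓝[>] τ)).exists
      exact lt_of_lt_of_le hτr (le_csSup (hbd u) ⟨a, ha, hr⟩)
    · intro h
      obtain ⟨r, hr, hτr⟩ := exists_lt_of_lt_csSup (hne u) h
      exact hlow _ _ (fun i => by simpa using hτr.le) hr
  refine ⟨fun u => sSup {τ : ℝ | (fun i => u i + τ) ∈ strictLowerHull A}, ?_, key, ?_⟩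
  -- In the sup norm, lowering `u'` by `dist u u'` puts it below `u`; the hull is a lower set, so
  -- the height is 1-Lipschitz.
  · refine (LipschitzWith.of_le_add fun u u' => ?_).continuous
    refine le_of_forall_lt fun τ hτ => ?_
    have h1 := (key u τ).2 hτ
    have h2 : (fun i => u' i + (τ - dist u u')) ∈ strictLowerHull A := by
      refine hlow _ _ (fun i => ?_) h1
      have h3 : |u i - u' i| ≤ dist u u' := by
        rw [← Real.dist_eq]; exact dist_le_pi_dist u u' i
      show u' i + (τ - dist u u') ≤ u i + τ
      linarith [(abs_le.1 h3).1]
    linarith [(key u' _).1 h2]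
  · intro u σ
    refine eq_of_forall_lt_iff fun τ => ?_
    rw [← key, lt_sub_iff_add_lt, ← key]
    simp only [add_assoc, add_comm σ]

/-- Straightening of the graph of a height function. -/
def heightHomeomorph (i₀ : Fin n) (g : (Fin n → ℝ) → ℝ) (hg : Continuous g)
    (hgσ : ∀ u σ, g (fun i => u i + σ) = g u - σ) : (Fin n → ℝ) ≃ₜ (Fin n → ℝ) where
  -- The differences `x j - x i₀` identify the diagonal line through `x`, and slot `i₀` locates the
  -- point on it, as the height has slope `-1` along the line.
  toFun x := Function.update (fun j => x j - x i₀) i₀ (g x)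
  invFun q := fun j => Function.update q i₀ 0 j + (g (Function.update q i₀ 0) - q i₀)
  left_inv x := by
    have h : Function.update (fun j => x j - x i₀) i₀ 0 = fun j => x j + -x i₀ := by
      ext j
      rcases eq_or_ne j i₀ with rfl | hj
      · simp
      · simp [Function.update_of_ne hj, sub_eq_add_neg]
    ext j
    simp only [Function.update_idem, h, hgσ, Function.update_self]
    ring
  right_inv q := by
    ext j
    rcases eq_or_ne j i₀ with rfl | hj
    · simp only [Function.update_self, hgσ]
      ring
    · simp [Function.update_of_ne hj]
  continuous_toFun := by fun_prop
  continuous_invFun := by fun_prop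

/-- A maximal, non-minimal `y` has some `z ≪ y` in `A`. Among points `≫ z`, the maximal elements are
exactly the zeros of the height: just below such a zero, points lie between `z` and an element of
`A`, hence in `A`; above it there are none. -/
lemma isHypersurface_maxElements_diff (i₀ : Fin n) (hA : A.OrdConnected) :
    IsHypersurface 0 (maxElements A \ minElements A) := by
  refine isHypersurface_zero_of_homeomorph fun y hy => ?_
  obtain ⟨hymax, hymin⟩ := hy
  obtain ⟨z, hzy, hz⟩ : ∃ z, StrongLT z y ∧ z ∈ A := by
    by_contra hcon
    push Not at hcon
    exact hymin ⟨hymax.1, hcon⟩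
  obtain ⟨g, hg, hgL, hgσ⟩ := exists_height hz (y₀ := y) fun ⟨a, ha, hya⟩ => hymax.2 a hya ha
  have hU : IsOpen {u : Fin n → ℝ | StrongLT z u} :=
    isOpen_iff_mem_nhds.2 fun u hu => eventually_strongLT_right hu
  have hcont : ∀ u : Fin n → ℝ, Tendsto (fun r : ℝ => fun i => u i + r) (𝓝 0) (𝓝 u) := fun u => by
    have := (by fun_prop : Continuous fun r : ℝ => fun i => u i + r).tendsto 0
    simpa using this
  refine ⟨(heightHomeomorph i₀ g hg hgσ).toOpenPartialHomeomorph.restrOpen _ hU, i₀,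
    by simpa using hzy, fun u hu => ?_⟩
  have hu' : StrongLT z u := by simpa using hu
  have hgu : (heightHomeomorph i₀ g hg hgσ) u i₀ = g u := by simp [heightHomeomorph]
  have hu0 : u ∈ strictLowerHull A ↔ 0 < g u := by simpa using hgL u 0
  show _ ↔ (heightHomeomorph i₀ g hg hgσ) u i₀ = 0
  rw [hgu]
  constructor
  · rintro ⟨hmax, -⟩
    refine le_antisymm (not_lt.1 fun h => ?_) (le_of_forall_lt fun τ hτ => ?_)
    · obtain ⟨a, ha, hua⟩ := hu0.2 h
      exact hmax.2 a hua ha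
    · exact (hgL u τ).1 (exists_strongGT_of_mem_closure (frontier_subset_closure hmax.1)
        fun i => by simpa using hτ)
  · intro h0
    have hnot : u ∉ strictLowerHull A := fun h => by simpa [h0] using hu0.1 h
    refine ⟨⟨⟨?_, ?_⟩, fun a hua ha => hnot ⟨a, ha, hua⟩⟩, fun hmin => hmin.2 z hu' hz⟩
    · refine mem_closure_of_tendsto ((hcont u).mono_left (nhdsWithin_le_nhds (s := Iio 0))) ?_
      filter_upwards [self_mem_nhdsWithin, ((hcont u).eventually
        (eventually_strongLT_right hu')).filter_mono nhdsWithin_le_nhds] with τ hτ hzτ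
      obtain ⟨a, ha, hτa⟩ := (hgL u τ).2 (by rw [h0]; exact hτ)
      exact hA.out hz ha ⟨hzτ.le, hτa.le⟩
    · intro hint
      have hev := (hcont u).eventually (mem_interior_iff_mem_nhds.1 hint)
      obtain ⟨τ, hτA, hτ⟩ := ((hev.filter_mono nhdsWithin_le_nhds).and
        (self_mem_nhdsWithin : Ioi (0 : ℝ) ∈ 𝓝[>] 0)).exists
      exact hnot ⟨_, hτA, fun i => by simpa using hτ⟩

lemma isHypersurface_minElements_diff (i₀ : Fin n) (hA : A.OrdConnected) :
    IsHypersurface 0 (minElements A \ maxElements A) := by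
  refine isHypersurface_zero_neg ?_
  have h : -(minElements A \ maxElements A) = maxElements (-A) \ minElements (-A) := by
    rw [← neg_minElements, ← neg_maxElements]
    rfl
  rw [h]
  refine isHypersurface_maxElements_diff i₀ ⟨fun x hx y hy z hz => ?_⟩
  exact hA.out hy hx ⟨neg_le_neg hz.2, neg_le_neg hz.1⟩

/-- A level set of a `C¹` function without critical points is a `C¹` hypersurface. -/
lemma isHypersurface_levelSet {B : Set (Fin n → ℝ)} {s : (Fin n → ℝ) → ℝ} (hB : IsOpen B)
    (hs : ContDiffOn ℝ 1 s B) (hs0 : ∀ x ∈ B, fderiv ℝ s x ≠ 0) (c : ℝ) :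
    IsHypersurface 1 (levelSet B s c) := by
  intro y hy
  obtain ⟨i, hi⟩ : ∃ i, fderiv ℝ s y (Pi.single i 1) ≠ 0 := by
    by_contra hcon
    push Not at hcon
    refine hs0 y hy.1 (ContinuousLinearMap.coe_injective ?_)
    exact (Pi.basisFun ℝ (Fin n)).ext fun i => by simpa using hcon i
  -- `G` replaces coordinate `i` by `s x - c`; its derivative is invertible exactly because the
  -- `i`-th partial derivative of `s` is nonzero.
  let G : (Fin n → ℝ) → (Fin n → ℝ) := fun x => x + (s x - c - x i) • (Pi.single i 1 : Fin n → ℝ)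
  have hGi : ∀ x, G x i = s x - c := fun x => by simp [G]
  have hVo : IsOpen (B ∩ {x | fderiv ℝ s x (Pi.single i 1) ≠ 0}) := by
    have : ContinuousOn (fun x => fderiv ℝ s x (Pi.single i 1)) B :=
      (hs.continuousOn_fderiv_of_isOpen hB le_rfl).clm_apply continuousOn_const
    exact this.isOpen_inter_preimage hB isOpen_compl_singleton
  have hGC : ∀ x ∈ B, ContDiffAt ℝ 1 G x := fun x hx => by
    have := hs.contDiffAt (hB.mem_nhds hx)
    exact contDiffAt_id.add (((this.sub contDiffAt_const).sub
      (contDiff_apply ℝ ℝ i).contDiffAt).smul contDiffAt_const)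
  have hGd : ∀ x ∈ B ∩ {x | fderiv ℝ s x (Pi.single i 1) ≠ 0},
      ∃ e : (Fin n → ℝ) ≃L[ℝ] (Fin n → ℝ), HasFDerivAt G (e : (Fin n → ℝ) →L[ℝ] (Fin n → ℝ)) x := by
    rintro x ⟨hx, hxi⟩
    have hsx : HasFDerivAt s (fderiv ℝ s x) x :=
      ((hs.differentiableOn one_ne_zero).differentiableAt (hB.mem_nhds hx)).hasFDerivAt
    have hd : HasFDerivAt G (ContinuousLinearMap.id ℝ (Fin n → ℝ) +
        (fderiv ℝ s x - ContinuousLinearMap.proj i).smulRight (Pi.single i 1 : Fin n → ℝ)) x :=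
      (hasFDerivAt_id x).add (((hsx.sub_const c).sub
        (ContinuousLinearMap.proj (R := ℝ) (φ := fun _ : Fin n => ℝ) i).hasFDerivAt).smul_const _)
    set T := ContinuousLinearMap.id ℝ (Fin n → ℝ) +
        (fderiv ℝ s x - ContinuousLinearMap.proj i).smulRight (Pi.single i 1 : Fin n → ℝ) with hT
    have hinj : Function.Injective T := by
      rw [injective_iff_map_eq_zero]
      intro h hh
      have hj : ∀ j, T h j = 0 := fun j => by rw [hh]; rfl
      have hne : ∀ j, j ≠ i → h j = 0 := fun j hji => by
        have := hj j
        simpa [hT, Pi.single_eq_of_ne hji] using this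
      have hsi : h = h i • (Pi.single i 1 : Fin n → ℝ) := by
        ext j
        rcases eq_or_ne j i with rfl | hji
        · simp
        · simp [hne j hji, Pi.single_eq_of_ne hji]
      have h1 : fderiv ℝ s x h = 0 := by
        have := hj i
        simpa [hT] using this
      rw [hsi, map_smul, smul_eq_mul] at h1
      rw [hsi, (mul_eq_zero.1 h1).resolve_right hxi, zero_smul]
    refine ⟨(LinearEquiv.ofInjectiveEndo (T : (Fin n → ℝ) →ₗ[ℝ] (Fin n → ℝ)) hinj).toContinuousLinearEquiv, ?_⟩
    convert hd using 1
    exact ContinuousLinearMap.ext fun _ => rfl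
  obtain ⟨e₀, he₀⟩ := hGd y ⟨hy.1, hi⟩
  have hy1 := hGC y hy.1
  refine ⟨(hy1.toOpenPartialHomeomorph G he₀ one_ne_zero).restrOpen _ hVo, i,
    ⟨hy1.mem_toOpenPartialHomeomorph_source he₀ one_ne_zero, hy.1, hi⟩, ?_, ?_, ?_⟩
  · rintro x ⟨-, hx⟩
    exact (hGC x hx.1).contDiffWithinAt
  · intro q hq
    have hx := (OpenPartialHomeomorph.map_target _ hq).2
    obtain ⟨e, he⟩ := hGd _ hx
    exact (OpenPartialHomeomorph.contDiffAt_symm _ hq he (hGC _ hx.1)).contDiffWithinAt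
  · rintro x ⟨-, hx⟩
    show x ∈ levelSet B s c ↔ G x i = 0
    rw [hGi, sub_eq_zero]
    exact ⟨fun h => h.2, fun h => ⟨hx.1, h⟩⟩

end OrderGeometry

/-! ### Sublevel sets of an increasing function without critical points. -/

section IncreasingFunction

variable {n : ℕ} {B : Set (Fin n → ℝ)} {s : (Fin n → ℝ) → ℝ}

/-- An increasing function without critical points increases strictly between points all of whose
coordinates are strictly ordered. -/
lemma lt_of_strongLT (hBc : B.OrdConnected) (hs : MonotoneOn s B)
    (hs0 : ∀ x ∈ B, fderiv ℝ s x ≠ 0) {x y : Fin n → ℝ} (hx : x ∈ B) (hy : y ∈ B)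
    (hxy : StrongLT x y) : s x < s y := by
  refine lt_of_le_of_ne (hs hx hy hxy.le) fun heq => ?_
  -- If the values at `x` and `y` agreed, `s` would be constant near the midpoint, which would be
  -- critical.
  have hm : StrongLT x (fun i => (x i + y i) / 2) := fun i => by
    have := hxy i
    show x i < (x i + y i) / 2
    linarith
  have hm' : StrongLT (fun i => (x i + y i) / 2) y := fun i => by
    have := hxy i
    show (x i + y i) / 2 < y i
    linarith
  refine hs0 _ (hBc.out hx hy ⟨hm.le, hm'.le⟩) ?_
  have : s =ᶠ[𝓝 (fun i => (x i + y i) / 2)] fun _ => s x := by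
    filter_upwards [eventually_strongLT_right hm, eventually_strongLT_left hm'] with u h1 h2
    have hu := hBc.out hx hy ⟨h1.le, h2.le⟩
    exact le_antisymm (heq ▸ hs hu hy h2.le) (hs hx hu h1.le)
  rw [this.fderiv_eq]
  simp

lemma mem_sublevel_ofReal {r : ℝ} (hr : 0 ≤ r) {x : Fin n → ℝ} :
    x ∈ sublevel B s (ENNReal.ofReal r) ↔ x ∈ B ∧ |s x| ≤ r := by
  simp [sublevel, ENNReal.ofReal_le_ofReal_iff hr]

lemma ordConnected_sublevel (hBc : B.OrdConnected) (hs : MonotoneOn s B) (α : ℝ≥0∞) :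
    (sublevel B s α).OrdConnected := by
  refine ⟨fun x hx y hy z hz => ?_⟩
  have hzB := hBc.out hx.1 hy.1 hz
  have h1 : |s z| ≤ max |s x| |s y| := abs_le_max_abs_abs (hs hx.1 hzB hz.1) (hs hzB hy.1 hz.2)
  refine ⟨hzB, ?_⟩
  rcases le_max_iff.1 h1 with h | h
  · exact (ENNReal.ofReal_le_ofReal h).trans hx.2
  · exact (ENNReal.ofReal_le_ofReal h).trans hy.2

/-- Near every point there are points strictly above and strictly below it at which a continuous
function takes nearby values. -/
lemma exists_strongLT_near (hB : IsOpen B) (hsc : ContinuousOn s B) {x : Fin n → ℝ} (hx : x ∈ B)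
    {W : Set ℝ} (hW : W ∈ 𝓝 (s x)) {U : Set (Fin n → ℝ)} (hU : U ∈ 𝓝 x) :
    (∃ z ∈ B ∩ U, StrongLT x z ∧ s z ∈ W) ∧ (∃ z ∈ B ∩ U, StrongLT z x ∧ s z ∈ W) := by
  have hc : Tendsto (fun r : ℝ => fun i => x i + r) (𝓝 0) (𝓝 x) := by
    have := (by fun_prop : Continuous fun r : ℝ => fun i => x i + r).tendsto 0
    simpa using this
  have hev : ∀ᶠ r : ℝ in 𝓝 0, (fun i => x i + r) ∈ B ∩ U ∧ s (fun i => x i + r) ∈ W :=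
    (hc.eventually (inter_mem (hB.mem_nhds hx) hU)).and
      (hc.eventually ((hsc.continuousAt (hB.mem_nhds hx)).eventually hW))
  constructor
  · obtain ⟨r, ⟨h1, h2⟩, hr⟩ := ((hev.filter_mono nhdsWithin_le_nhds).and
      (self_mem_nhdsWithin : Ioi (0 : ℝ) ∈ 𝓝[>] 0)).exists
    exact ⟨_, h1, fun i => by simpa using hr, h2⟩
  · obtain ⟨r, ⟨h1, h2⟩, hr⟩ := ((hev.filter_mono nhdsWithin_le_nhds).and
      (self_mem_nhdsWithin : Iio (0 : ℝ) ∈ 𝓝[<] 0)).exists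
    exact ⟨_, h1, fun i => by simpa using hr, h2⟩

/-- Continuity excludes `|s| ≠ r` on the boundary. Conversely, from `s = r` a small step strictly
up, and from `s = -r` one strictly down, leaves the sublevel set. -/
lemma frontier_sublevel_inter (hB : IsOpen B) (hBc : B.OrdConnected) (hs : MonotoneOn s B)
    (hsc : ContinuousOn s B) (hs0 : ∀ x ∈ B, fderiv ℝ s x ≠ 0) {r : ℝ} (hr : 0 ≤ r) :
    frontier (sublevel B s (ENNReal.ofReal r)) ∩ B = isostable B s r := by
  ext x
  constructor
  · rintro ⟨hxf, hxB⟩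
    refine ⟨hxB, ?_⟩
    have hcx : ContinuousAt (fun z => |s z|) x := (hsc.continuousAt (hB.mem_nhds hxB)).abs
    refine le_antisymm (not_lt.1 fun h => ?_) (not_lt.1 fun h => ?_)
    · obtain ⟨z, hz, hz'⟩ := ((mem_closure_iff_frequently.1 hxf.1).and_eventually
        (hcx.eventually (lt_mem_nhds h))).exists
      exact absurd ((mem_sublevel_ofReal hr).1 hz).2 (not_le.2 hz')
    · refine hxf.2 (mem_interior_iff_mem_nhds.2 ?_)
      filter_upwards [hB.mem_nhds hxB, hcx.eventually (gt_mem_nhds h)] with z hz hz'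
      exact (mem_sublevel_ofReal hr).2 ⟨hz, hz'.le⟩
  · rintro ⟨hxB, hxr⟩
    refine ⟨⟨subset_closure ((mem_sublevel_ofReal hr).2 ⟨hxB, hxr.le⟩), fun hint => ?_⟩, hxB⟩
    obtain ⟨⟨z, hz, hxz, -⟩, ⟨z', hz', hzx', -⟩⟩ := exists_strongLT_near hB hsc hxB univ_mem
      (mem_interior_iff_mem_nhds.1 hint)
    have h1 := lt_of_strongLT hBc hs hs0 hxB hz.1 hxz
    have h2 := lt_of_strongLT hBc hs hs0 hz'.1 hxB hzx'
    have h3 := abs_le.1 ((mem_sublevel_ofReal hr).1 hz.2).2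
    have h4 := abs_le.1 ((mem_sublevel_ofReal hr).1 hz'.2).2
    rcases (abs_eq hr).1 hxr with h | h <;> linarith

lemma isostable_eq_union {r : ℝ} (hr : 0 ≤ r) :
    isostable B s r = levelSet B s (-r) ∪ levelSet B s r := by
  ext x
  simp only [isostable, levelSet, mem_union, mem_ofPred_eq, ← and_or_left, abs_eq hr]
  rw [or_comm]

lemma minElements_sublevel_inter (hB : IsOpen B) (hBc : B.OrdConnected) (hs : MonotoneOn s B)
    (hsc : ContinuousOn s B) (hs0 : ∀ x ∈ B, fderiv ℝ s x ≠ 0) {r : ℝ} (hr : 0 ≤ r) :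
    minElements (sublevel B s (ENNReal.ofReal r)) ∩ B = levelSet B s (-r) := by
  have hfr := frontier_sublevel_inter hB hBc hs hsc hs0 hr
  ext x
  constructor
  · rintro ⟨⟨hxf, hmin⟩, hxB⟩
    have hx : x ∈ isostable B s r := hfr ▸ ⟨hxf, hxB⟩
    refine ⟨hxB, ?_⟩
    by_contra hne
    have hxr : s x = r := ((abs_eq hr).1 hx.2).resolve_right hne
    -- For `r = 0` the two levels coincide, so `hne` already fails.
    have hlt : -r < s x := by
      rcases hr.lt_or_eq with h | h
      · linarith
      · exact absurd (by rw [hxr, ← h, neg_zero]) hne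
    obtain ⟨-, z, hz, hzx, hzr⟩ := exists_strongLT_near hB hsc hxB (lt_mem_nhds hlt) univ_mem
    refine hmin z hzx ((mem_sublevel_ofReal hr).2 ⟨hz.1, abs_le.2 ⟨le_of_lt hzr, ?_⟩⟩)
    exact (hs hz.1 hxB hzx.le).trans hxr.le
  · rintro ⟨hxB, hxr⟩
    have hx : x ∈ isostable B s r := ⟨hxB, by rw [hxr, abs_neg, abs_of_nonneg hr]⟩
    rw [← hfr] at hx
    refine ⟨⟨hx.1, fun z hzx hz => ?_⟩, hxB⟩
    have hz' := (mem_sublevel_ofReal hr).1 hz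
    have := lt_of_strongLT hBc hs hs0 hz'.1 hxB hzx
    linarith [(abs_le.1 hz'.2).1]

lemma maxElements_sublevel_inter (hB : IsOpen B) (hBc : B.OrdConnected) (hs : MonotoneOn s B)
    (hsc : ContinuousOn s B) (hs0 : ∀ x ∈ B, fderiv ℝ s x ≠ 0) {r : ℝ} (hr : 0 ≤ r) :
    maxElements (sublevel B s (ENNReal.ofReal r)) ∩ B = levelSet B s r := by
  have hfr := frontier_sublevel_inter hB hBc hs hsc hs0 hr
  ext x
  constructor
  · rintro ⟨⟨hxf, hmax⟩, hxB⟩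
    have hx : x ∈ isostable B s r := hfr ▸ ⟨hxf, hxB⟩
    refine ⟨hxB, ?_⟩
    by_contra hne
    have hxr : s x = -r := ((abs_eq hr).1 hx.2).resolve_left hne
    have hlt : s x < r := by
      rcases hr.lt_or_eq with h | h
      · linarith
      · exact absurd (by rw [hxr, ← h, neg_zero]) hne
    obtain ⟨⟨z, hz, hxz, hzr⟩, -⟩ := exists_strongLT_near hB hsc hxB (gt_mem_nhds hlt) univ_mem
    refine hmax z hxz ((mem_sublevel_ofReal hr).2 ⟨hz.1, abs_le.2 ⟨?_, le_of_lt hzr⟩⟩)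
    exact hxr.ge.trans (hs hxB hz.1 hxz.le)
  · rintro ⟨hxB, hxr⟩
    have hx : x ∈ isostable B s r := ⟨hxB, by rw [hxr, abs_of_nonneg hr]⟩
    rw [← hfr] at hx
    refine ⟨⟨hx.1, fun z hxz hz => ?_⟩, hxB⟩
    have hz' := (mem_sublevel_ofReal hr).1 hz
    have := lt_of_strongLT hBc hs hs0 hxB hz'.1 hxz
    linarith [(abs_le.1 hz'.2).2]

end IncreasingFunction

/-! ### Consequences of the eigenfunction identity for sublevel and level sets. -/

section KoopmanSublevel

variable {n : ℕ} {f : (Fin n → ℝ) → (Fin n → ℝ)} {D : Set (Fin n → ℝ)} {p : Fin n → ℝ}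
  {s : (Fin n → ℝ) → ℝ} {l : ℝ}

/-- Since `l < 0`, `|s|` does not increase along trajectories, so sublevel sets are forward
invariant. -/
lemma isPathConnected_sublevel (hp : p ∈ D) (hst : IsStableHyperbolic f p) (hl : l < 0)
    (hs : IsKoopmanEigenfunction f D (basin f D p) s l) (α : ℝ≥0∞) :
    IsPathConnected (sublevel (basin f D p) s α) := by
  refine isPathConnected_of_forward_invariant (fun _ h => h.1)
    ⟨self_mem_basin hp hst.1, by simp [koopman_apply_self hp hst hs hl]⟩ ?_
  intro γ hγ hlim h0 t ht
  refine ⟨mem_basin_of_forward hγ hlim ht, le_trans (ENNReal.ofReal_le_ofReal ?_) h0.2⟩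
  rw [hs γ hγ h0.1 t ht, abs_mul, Real.abs_exp]
  refine mul_le_of_le_one_left (abs_nonneg _) ?_
  rw [Real.exp_le_one_iff]
  exact mul_nonpos_of_nonpos_of_nonneg hl.le ht

/-- For a strongly monotone system, a level set of the eigenfunction contains no two ordered
points. -/
lemma not_lt_of_mem_levelSet (hBc : (basin f D p).OrdConnected) (hmono : MonotoneOn s (basin f D p))
    (hs0 : ∀ x ∈ basin f D p, fderiv ℝ s x ≠ 0)
    (hs : IsKoopmanEigenfunction f D (basin f D p) s l)
    (hsm : IsStronglyMonotoneSystem f D (basin f D p)) {c : ℝ} {x y : Fin n → ℝ}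
    (hx : x ∈ levelSet (basin f D p) s c) (hy : y ∈ levelSet (basin f D p) s c) : ¬ y < x := by
  intro hlt
  obtain ⟨hxB, hxc⟩ := hx
  obtain ⟨hyB, hyc⟩ := hy
  obtain ⟨γ, hγ, rfl, hγp⟩ := id hxB
  obtain ⟨η, hη, rfl, hηp⟩ := id hyB
  -- Any positive time would do: the flow upgrades `<` to `≪` while scaling both equal values of `s`
  -- by the same factor.
  have h1 := hsm.2 η γ hη hγ hyB hxB hlt 1 one_pos
  have h2 := lt_of_strongLT hBc hmono hs0 (mem_basin_of_forward hη hηp zero_le_one)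
    (mem_basin_of_forward hγ hγp zero_le_one) h1
  rw [hs γ hγ hxB 1 zero_le_one, hs η hη hyB 1 zero_le_one, hxc, hyc] at h2
  exact lt_irrefl _ h2

end KoopmanSublevel

end MonotoneSystems

theorem mainTheorem4 {n : ℕ}
    (f : (Fin n → ℝ) → (Fin n → ℝ)) (D : Set (Fin n → ℝ)) (xs : Fin n → ℝ)
    -- the system `ẋ = f(x)` on an open order-convex domain, with `f` of class `C²`
    (hDo : IsOpen D) (hDc : D.OrdConnected) (hf : ContDiffOn ℝ 2 f D)
    -- a stable hyperbolic fixed point, and monotonicity on its basin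
    (hxs : xs ∈ D) (hst : MonotoneSystems.IsStableHyperbolic f xs)
    (hmon : MonotoneSystems.IsMonotoneSystem f D (MonotoneSystems.basin f D xs))
    -- the dominant eigenvalue of the Jacobian matrix at `xs`, with a right eigenvector `v`
    (l : ℝ) (hl : MonotoneSystems.IsDominantEigenvalue (MonotoneSystems.jacobian f xs) l)
    (v : Fin n → ℝ) (hv : (MonotoneSystems.jacobian f xs).mulVec v = l • v)
    -- choice of the sign of `v`
    (hvpos : ∃ i, 0 < v i)
    -- the dominant eigenfunction, of class `C¹` on the basin, normalized by `v`
    (s : (Fin n → ℝ) → ℝ) (hsC : ContDiffOn ℝ 1 s (MonotoneSystems.basin f D xs))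
    (hs : MonotoneSystems.IsKoopmanEigenfunction f D (MonotoneSystems.basin f D xs) s l)
    (hsv : fderiv ℝ s xs v = 1)
    -- if `l` is not a simple eigenvalue, then `s` is chosen among its eigenfunctions as an
    -- increasing one; nothing is required of a simple eigenvalue
    (hchoice : (MonotoneSystems.jacobian f xs).charpoly.rootMultiplicity l ≠ 1 →
      MonotoneOn s (MonotoneSystems.basin f D xs)) :
    -- (i)
    (∀ α : ℝ≥0∞,
      (MonotoneSystems.sublevel (MonotoneSystems.basin f D xs) s α).OrdConnected ∧
      IsPathConnected (MonotoneSystems.sublevel (MonotoneSystems.basin f D xs) s α)) ∧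
    -- (ii), topological boundary, `α = ∞` included
    (∀ α : ℝ≥0∞, ∀ A : Set (Fin n → ℝ),
      A = MonotoneSystems.sublevel (MonotoneSystems.basin f D xs) s α →
      frontier A = MonotoneSystems.minElements A ∪ MonotoneSystems.maxElements A ∧
      (∀ x ∈ MonotoneSystems.minElements A, ∀ y ∈ MonotoneSystems.minElements A,
        ¬ StrongLT y x) ∧
      (∀ x ∈ MonotoneSystems.maxElements A, ∀ y ∈ MonotoneSystems.maxElements A,
        ¬ StrongLT y x) ∧
      MonotoneSystems.IsHypersurface 0
        (MonotoneSystems.minElements A \ MonotoneSystems.maxElements A) ∧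
      MonotoneSystems.IsHypersurface 0
        (MonotoneSystems.maxElements A \ MonotoneSystems.minElements A)) ∧
    -- (ii), finite `α`: the isostable and its two parts
    (∀ r : ℝ, 0 ≤ r → ∀ B A : Set (Fin n → ℝ), B = MonotoneSystems.basin f D xs →
      A = MonotoneSystems.sublevel B s (ENNReal.ofReal r) →
      frontier A ∩ B = MonotoneSystems.isostable B s r ∧
      MonotoneSystems.isostable B s r =
        MonotoneSystems.levelSet B s (-r) ∪ MonotoneSystems.levelSet B s r ∧
      MonotoneSystems.minElements A ∩ B = MonotoneSystems.levelSet B s (-r) ∧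
      MonotoneSystems.maxElements A ∩ B = MonotoneSystems.levelSet B s r ∧
      MonotoneSystems.IsHypersurface 1 (MonotoneSystems.levelSet B s (-r)) ∧
      MonotoneSystems.IsHypersurface 1 (MonotoneSystems.levelSet B s r)) ∧
    -- (iii)
    (MonotoneSystems.IsStronglyMonotoneSystem f D (MonotoneSystems.basin f D xs) →
      ∀ r : ℝ, 0 ≤ r → ∀ c : ℝ, c = r ∨ c = -r →
        ∀ x ∈ MonotoneSystems.levelSet (MonotoneSystems.basin f D xs) s c,
        ∀ y ∈ MonotoneSystems.levelSet (MonotoneSystems.basin f D xs) s c, ¬ y < x) := by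
  have hl0 : l < 0 := by simpa using hst.2 l hl.1
  have hB := MonotoneSystems.isOpen_basin hDo hf hxs hst
  have hBc := MonotoneSystems.ordConnected_basin hDo hDc hf hxs hst hmon
  have hsc := hsC.continuousOn
  have hs0 : ∀ x ∈ MonotoneSystems.basin f D xs, fderiv ℝ s x ≠ 0 := fun x hx =>
    MonotoneSystems.fderiv_ne_zero_of_mem_basin hDo hf hxs hst hsC hs
      (fun h => by simp [h] at hsv) hx
  have hmono : MonotoneOn s (MonotoneSystems.basin f D xs) := by
    by_cases hsimple : (MonotoneSystems.jacobian f xs).charpoly.rootMultiplicity l = 1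
    · exact MonotoneSystems.monotoneOn_of_simple_dominant hDo hf hxs hst hmon hl hsimple hv hvpos
        hsC hs hsv
    · exact hchoice hsimple
  -- The index shows that `n ≠ 0`, so there is a coordinate in which to straighten the boundary.
  obtain ⟨i₀, -⟩ := hvpos
  refine ⟨fun α => ⟨MonotoneSystems.ordConnected_sublevel hBc hmono α,
    MonotoneSystems.isPathConnected_sublevel hxs hst hl0 hs α⟩, ?_, ?_, ?_⟩
  · rintro α A rfl
    have hA := MonotoneSystems.ordConnected_sublevel hBc hmono α
    exact ⟨MonotoneSystems.frontier_eq_minElements_union_maxElements hA,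
      fun x hx y hy => MonotoneSystems.not_strongLT_of_mem_minElements hx hy,
      fun x hx y hy => MonotoneSystems.not_strongLT_of_mem_maxElements hx hy,
      MonotoneSystems.isHypersurface_minElements_diff i₀ hA,
      MonotoneSystems.isHypersurface_maxElements_diff i₀ hA⟩
  · rintro r hr B A rfl rfl
    exact ⟨MonotoneSystems.frontier_sublevel_inter hB hBc hmono hsc hs0 hr,
      MonotoneSystems.isostable_eq_union hr,
      MonotoneSystems.minElements_sublevel_inter hB hBc hmono hsc hs0 hr,
      MonotoneSystems.maxElements_sublevel_inter hB hBc hmono hsc hs0 hr,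
      MonotoneSystems.isHypersurface_levelSet hB hsC hs0 (-r),
      MonotoneSystems.isHypersurface_levelSet hB hsC hs0 r⟩
  · intro hsm r _ c _ x hx y hy
    exact MonotoneSystems.not_lt_of_mem_levelSet hBc hmono hs0 hs hsm hx hy
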